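/- **Theorem.** The emptiness problem for realtime private alternating finite automata is undecidable: there is no algorithm that, given (a finite description of) a realtime private alternating finite automaton $M$, decides whether $L(M)=\emptyset$. Here a *realtime private alternating finite automaton* (PAFA) is a tuple $M=(S_c,S_p,\Sigma,U,\delta_E,\delta_U,s_{c0},s_{p0},q_a,q_r,\Gamma,\Delta)$, where $S_c$, $S_p$ are finite sets (common and private state components), $\Sigma$ is a finite input alphabet with an end-marker $\#\notin\Sigma$, $\Gamma$ and $\Delta$ are disjoint finite sets (public and private game alphabets) with at least two symbols each, $U\subseteq S_c\times S_p$ is the set of universal states (the other states in $S_c\times S_p$ are existential), $s_{c0}\in S_c$, $s_{p0}\in S_p$, $q_a,q_r\in S_c$, and $\delta_E:S_c\to\mathcal P(S_c)$, $\delta_U:S_c\times S_p\times(\Sigma\cup\{\#\})\to\mathcal P(S_c\times S_p)$ are such that: * every value of $\delta_E$ is either a singleton or a set of $|\Gamma|$ elements, labelled bijectively by $\Gamma$; * every value of $\delta_U$ is either a singleton or a set of $|\Gamma\cup\Delta|$ elements, labelled bijectively by $\Gamma\cup\Delta$, and in the latter case the elements of $\delta_U(s_c,s_p,\sigma)$ labelled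 by symbols of $\Gamma$ have private component $s_p$. A transition from an existential state $(s_c,s_p)$ leads to some $(s_c',s_p)$ with $s_c'\in\delta_E(s_c)$; a transition from a universal state $(s_c,s_p)$ while scanning $\sigma$ leads to some element of $\delta_U(s_c,s_p,\sigma)$. On an input $w\in\Sigma^*$ of length $n$ the tape contains $\# w\#$, and $M$ makes exactly two transitions on each of the $n+2$ tape symbols, from left to right. The *computation tree* of $M$ on $w$ is the resulting tree of depth $2n+4$, whose root is labelled $(s_{c0},s_{p0})$ and whose nodes correspond to the sequences of transitions from the root. The *public moves seen by* a node is the string in $\Gamma^*$ of the labels in $\Gamma$ of the transitions, made from existential or universal states, on the path from the root to this node (a transition from a state with a single successor carries no label). The automaton $M$ *accepts* $w$ if the computation tree has a subtree that contains the root, exactly one child of each of its existential nodes and all children of each of its universal nodes (at levels below $2n+4$), in which all nodes at level $2n+4$ have common state component $q_a$, and in which any two existential nodes (possibly at different levels) with the same common state component that have seen the same public moves make the same move, i.e. proceed by equally labelled (or both unlabelled) transitions. $L(M)$ is the set of all $w\in\Sigma^*$ accepted by $M$. -/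

import Mathlib

/-- The value of a transition function: either a single successor, or one successor for each
label in `L`, distinct labels leading to distinct successors. -/
inductive LabelledMove (L α : Type) : Type
  | single (t : α) : LabelledMove L α
  | choice (f : L ↪ α) : LabelledMove L α

/-- A realtime private alternating finite automaton with common state components `C`, private
state components `P`, input alphabet `A`, public game alphabet `G` and private game alphabet `D`.
The disjoint union of the two game alphabets is `G ⊕ D`; a tape symbol is an element of
`Option A`, with `none` for the end-marker. -/
structure PAFA (C P A G D : Type) [Finite C] [Finite P] [Finite A] [Finite G] [Finite D] where
  /-- `(c, p)` is a universal state if the value is `true`, an existential one otherwise. -/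
  isUniversal : C → P → Bool
  /-- The existential transition function: it sees and changes only the common component. -/
  deltaE : C → LabelledMove G C
  /-- The universal transition function. -/
  deltaU : C → P → Option A → LabelledMove (G ⊕ D) (C × P)
  initC : C
  initP : P
  accept : C
  reject : C
  public_nontrivial : Nontrivial G
  private_nontrivial : Nontrivial D
  /-- A public move of the universal player leaves the private component unchanged. -/
  public_move : ∀ c p a f, deltaU c p a = .choice f → ∀ g : G, (f (Sum.inl g)).2 = p

namespace PAFA

variable {C P A G D : Type} [Finite C] [Finite P] [Finite A] [Finite G] [Finite D]

/-- The tape content for the input `w`: the word `w` between two end-markers. -/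
def tape (w : List A) : List (Option A) :=
  none :: (w.map some ++ [none])

/-- The depth of the computation tree: two transitions for each tape symbol. -/
def depth (w : List A) : ℕ :=
  2 * (tape w).length

/-- The symbol scanned at a node of level `i < depth w`. -/
def scanned (w : List A) (i : ℕ) : Option A :=
  (tape w).getD (i / 2) none

/-- An edge of the computation tree: the label of the move (`none` if the state has a single
successor, which is no move of the game) and the state that is reached. -/
abbrev Edge (C P G D : Type) : Type := Option (G ⊕ D) × (C × P)

/-- A node of the computation tree, given by the edges on the path to it from the root, the most
recent edge first. Its level is the length of the list. -/
abbrev Node (C P G D : Type) : Type := List (Edge C P G D)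

/-- The state that labels a node. -/
def state (M : PAFA C P A G D) : Node C P G D → C × P
  | [] => (M.initC, M.initP)
  | e :: _ => e.2

/-- `M.Step s a e`: from the state `s`, scanning the tape symbol `a`, there is the edge `e`. -/
def Step (M : PAFA C P A G D) (s : C × P) (a : Option A) (e : Edge C P G D) : Prop :=
  match M.isUniversal s.1 s.2 with
  | true =>
    match M.deltaU s.1 s.2 a with
    | .single t => e = (none, t)
    | .choice f => ∃ l : G ⊕ D, e = (some l, f l)
  | false =>
    match M.deltaE s.1 with
    | .single c => e = (none, (c, s.2))
    | .choice f => ∃ g : G, e = (some (Sum.inl g), (f g, s.2))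

/-- The computation tree on the input `w`, as the set of its nodes. -/
inductive ComputationTree (M : PAFA C P A G D) (w : List A) : Node C P G D → Prop
  | root : ComputationTree M w []
  | child (N : Node C P G D) (e : Edge C P G D) :
      ComputationTree M w N → N.length < depth w →
      M.Step (M.state N) (scanned w N.length) e → ComputationTree M w (e :: N)

/-- The node is labelled by a universal state. -/
def IsUniversalNode (M : PAFA C P A G D) (N : Node C P G D) : Prop :=
  M.isUniversal (M.state N).1 (M.state N).2 = true

/-- The public symbol of an edge, if its label belongs to the public game alphabet. -/
def publicLabel (e : Edge C P G D) : Option G :=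
  e.1.bind Sum.getLeft?

/-- The public moves seen by a node: the string of all moves, of either player, that are made on
the path from the root to the node and are named by a symbol of the public game alphabet. -/
def publicMoves (N : Node C P G D) : List G :=
  N.reverse.filterMap publicLabel

/-- `T` is an accepting computation subtree on the input `w`. -/
structure IsAcceptingSubtree (M : PAFA C P A G D) (w : List A) (T : Set (Node C P G D)) :
    Prop where
  subset : ∀ N ∈ T, M.ComputationTree w N
  root_mem : [] ∈ T
  parent_mem : ∀ N e, e :: N ∈ T → N ∈ T
  /-- exactly one child of every existential inner node -/
  existential : ∀ N ∈ T, N.length < depth w → ¬ M.IsUniversalNode N → ∃! e, e :: N ∈ T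
  /-- all children of every universal inner node -/
  universal : ∀ N ∈ T, M.IsUniversalNode N →
    ∀ e, M.ComputationTree w (e :: N) → e :: N ∈ T
  /-- all leaves are accepting -/
  leaf : ∀ N ∈ T, N.length = depth w → (M.state N).1 = M.accept
  /-- Two existential nodes, possibly of different levels, with the same common state component
  that have seen the same public moves make the same move. -/
  privacy : ∀ N₁ N₂ e₁ e₂, e₁ :: N₁ ∈ T → e₂ :: N₂ ∈ T →
    ¬ M.IsUniversalNode N₁ → ¬ M.IsUniversalNode N₂ →
    (M.state N₁).1 = (M.state N₂).1 → publicMoves N₁ = publicMoves N₂ → e₁.1 = e₂.1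

/-- The language recognized by the automaton. -/
def language (M : PAFA C P A G D) : Set (List A) :=
  {w | ∃ T, M.IsAcceptingSubtree w T}

end PAFA

/-! Finite descriptions of automata, the instances of decision problems. -/

/-- The type of finite descriptions: the sizes of the five finite sets; the table of universal
states; the tables of the two transition functions, each value being written as the list of the
successor states; and the initial components and the accepting and rejecting components. -/
abbrev PAFADescription : Type :=
  (ℕ × ℕ × ℕ × ℕ × ℕ) × List (List Bool) × List (List ℕ) ×
    List (List (List (List (ℕ × ℕ)))) × (ℕ × ℕ × ℕ × ℕ)

namespace PAFA

variable {nC nP nA nG nD : ℕ}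

/-- A value of the existential transition function as a list, in the order of the labels. -/
def describeE : LabelledMove (Fin nG) (Fin nC) → List ℕ
  | .single c => [(c : ℕ)]
  | .choice f => List.ofFn fun g => (f g : ℕ)

/-- A value of the universal transition function as a list, in the order of the labels,
public labels first. -/
def describeU : LabelledMove (Fin nG ⊕ Fin nD) (Fin nC × Fin nP) → List (ℕ × ℕ)
  | .single t => [((t.1 : ℕ), (t.2 : ℕ))]
  | .choice f =>
      (List.ofFn fun g => (((f (Sum.inl g)).1 : ℕ), ((f (Sum.inl g)).2 : ℕ))) ++
        List.ofFn fun d => (((f (Sum.inr d)).1 : ℕ), ((f (Sum.inr d)).2 : ℕ))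

/-- The finite description of an automaton whose sets are initial segments of `ℕ`. -/
def describe (M : PAFA (Fin nC) (Fin nP) (Fin nA) (Fin nG) (Fin nD)) : PAFADescription :=
  ((nC, nP, nA, nG, nD),
    (List.ofFn fun c => List.ofFn fun p => M.isUniversal c p),
    (List.ofFn fun c => describeE (M.deltaE c)),
    (List.ofFn fun c => List.ofFn fun p =>
      describeU (M.deltaU c p none) ::
        List.ofFn fun a => describeU (M.deltaU c p (some a))),
    ((M.initC : ℕ), (M.initP : ℕ), (M.accept : ℕ), (M.reject : ℕ)))

theorem describeE_inj (h : 2 ≤ nG) : Function.Injective (describeE (nG := nG) (nC := nC)) := by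
  intro x y hxy
  cases x with
  | single a => cases y with
    | single b => simp [describeE] at hxy; rw [Fin.ext hxy]
    | choice f => have := congrArg List.length hxy; simp [describeE] at this; omega
  | choice f => cases y with
    | single b => have := congrArg List.length hxy; simp [describeE] at this; omega
    | choice f' =>
      have := List.ofFn_injective hxy
      congr 1; ext g; exact congrFun this g

theorem describeU_inj (h : 2 ≤ nG) :
    Function.Injective (describeU (nG := nG) (nC := nC) (nP := nP) (nD := nD)) := by
  intro x y hxy
  cases x with
  | single a => cases y with
    | single b => simp [describeU] at hxy; rw [Prod.ext (Fin.ext hxy.1) (Fin.ext hxy.2)]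
    | choice f => have := congrArg List.length hxy; simp [describeU] at this; omega
  | choice f => cases y with
    | single b => have := congrArg List.length hxy; simp [describeU] at this; omega
    | choice f' =>
      simp only [describeU] at hxy
      obtain ⟨h1, h2⟩ := List.append_inj hxy (by simp)
      have h1 := List.ofFn_injective h1
      have h2 := List.ofFn_injective h2
      congr 1; ext l
      all_goals rcases l with g | g
      all_goals first
        | exact (Prod.ext_iff.1 (congrFun h1 g)).1
        | exact (Prod.ext_iff.1 (congrFun h2 g)).1
        | exact (Prod.ext_iff.1 (congrFun h1 g)).2
        | exact (Prod.ext_iff.1 (congrFun h2 g)).2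

/-- An automaton is determined by its description. -/
theorem describe_injective :
    Function.Injective (describe (nC := nC) (nP := nP) (nA := nA) (nG := nG) (nD := nD)) := by
  intro M N h
  have h2 : 2 ≤ nG := Fin.nontrivial_iff_two_le.1 M.public_nontrivial
  simp only [describe, Prod.mk.injEq, List.ofFn_inj, true_and] at h
  obtain ⟨hu, he, hU, h3⟩ := h
  cases M; cases N
  simp only [PAFA.mk.injEq]
  refine ⟨?_, ?_, ?_, Fin.ext h3.1, Fin.ext h3.2.1, Fin.ext h3.2.2.1, Fin.ext h3.2.2.2⟩
  · funext c p; exact congrFun (List.ofFn_injective (congrFun hu c)) p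
  · funext c; exact describeE_inj h2 (congrFun he c)
  · funext c p a
    have := List.ofFn_injective (congrFun hU c)
    have := congrFun this p
    simp only [List.cons.injEq, List.ofFn_inj] at this
    cases a with
    | none => exact describeU_inj h2 this.1
    | some a => exact describeU_inj h2 (congrFun this.2 a)

end PAFA

/-! Some fixed Turing machine has an undecidable halting problem on the inputs `X Y … Y`
(`Turing.exists_TM0_undecidable`). For each input length an automaton is built that accepts exactly
the words describing a halting computation on that input, so its language is empty if and only if
the machine does not halt.

Such a word lists the configurations as rows of a common length `k`, each opened by a separator.
Since `k` is not bounded in advance, no finite control can by itself compare letters at distance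
`k`; private information does it. The existential player recites the word letter by letter through
public moves. At the start, a private move of the universal player decides whether the recital is
compared with the tape at once, or begins only after the first row has been read. The first
possibility forces the recital to be the input word. In the second, the existential player meets the
same common component and the same public moves, hence must recite the same word, now `k` letters
behind the tape head. The private control thus sees the letters at positions `j` and `k + j`
together, without storing `k`. This is `Checker.mem_language_iff`.

A letter is a cell together with its two neighbours, because a comparison at distance exactly `k`
must yield all that determines the new cell. Consecutive letters are checked to overlap, letters at
distance `k` to obey the update rule, and the first row to hold the initial configuration. By
induction on rows, such words with a halted cell behind the first row exist if and only if the
machine halts (`Turing.TM0.exists_accepts_iff`).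

The machine being fixed, the input length enters only through a counter of `n + 1` private states
used on the first row. All else in the description is constant, so it is primitive recursive in `n`
(`Turing.TM0.primrec_describe`), which gives a many-one reduction. -/

/-! ### A Turing machine with an undecidable halting problem -/

namespace Turing

open StateTransition

namespace TM0

variable {Γ Λ : Type} [Inhabited Γ] [Inhabited Λ]

/-- The restriction of a machine to a set of states that supports it. -/
def Machine.restrict (M : Machine Γ Λ) (S : Set Λ) (hS : Supports M S) [Inhabited S] :
    Machine Γ S :=
  fun q a => (M q a).pmap (p := fun p => p.1 ∈ S) (fun p hp => (⟨p.1, hp⟩, p.2))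
    (fun p hp => let ⟨_, _⟩ := p; hS.2 hp q.2)

theorem restrict_respects (M : Machine Γ Λ) (S : Set Λ) (hS : Supports M S) [Inhabited S] :
    Respects (step M) (step (M.restrict S hS))
      (fun c₁ c₂ => c₁.q = c₂.q ∧ c₁.Tape = c₂.Tape) := by
  rintro ⟨q, T⟩ ⟨⟨q₂, hq⟩, T₂⟩ ⟨h₁, h₂⟩
  dsimp only at h₁ h₂
  subst h₁ h₂
  cases h : M q T.1 with
  | none => simp [step, Machine.restrict, h]
  | some p =>
    obtain ⟨q', s⟩ := p
    simp only [step, h, Option.map_some]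
    refine ⟨⟨⟨q', hS.2 h hq⟩, _⟩, ⟨rfl, rfl⟩, Relation.TransGen.single ?_⟩
    simp [step, Machine.restrict, h]

end TM0

namespace PartrecToTM2

instance : Finite K' :=
  Finite.of_surjective (fun i : Fin 4 => ![K'.main, K'.rev, K'.aux, K'.stack] i) (by
    rintro (_ | _ | _ | _)
    exacts [⟨0, rfl⟩, ⟨1, rfl⟩, ⟨2, rfl⟩, ⟨3, rfl⟩])

/-- Numerals are written in binary, and these numbers have only digits 1. They allow inputs that are
runs of a single symbol, which a counter can recognize. -/
theorem trNat_two_pow_sub_one (m : ℕ) : trNat (2 ^ m - 1) = List.replicate m Γ'.bit1 := by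
  induction m with
  | zero => simp
  | succ m ih =>
    have h : 2 ^ (m + 1) - 1 = Nat.bit true (2 ^ m - 1) := by
      have := Nat.one_le_two_pow (n := m)
      simp only [Nat.bit_val, pow_succ, Bool.toNat_true]
      omega
    rw [h, List.replicate_succ, ← ih]
    simp only [trNat]
    rw [← Num.ofNat'_eq, ← Num.ofNat'_eq, Num.ofNat'_bit]
    cases Num.ofNat' (2 ^ m - 1) <;> rfl

end PartrecToTM2

open PartrecToTM2 in
/-- For every code there is a finite Turing machine that halts on its input, a fixed symbol
followed by `m` copies of another one, if and only if the code is defined at `2 ^ m - 1`. -/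
theorem exists_finite_TM0 (c : ToPartrec.Code) :
    ∃ (Γ Λ : Type) (_ : Inhabited Γ) (_ : Inhabited Λ) (_ : Finite Γ) (_ : Finite Λ)
      (M : TM0.Machine Γ Λ) (X Y : Γ), ∀ m : ℕ,
        (eval (TM0.step M) (TM0.init (X :: List.replicate m Y))).Dom ↔
          (c.eval [2 ^ m - 1]).Dom := by
  classical
  -- Machines start in the default state, so this instance is what makes the machine run `c`.
  let : Inhabited Λ' := ⟨trNormal c Cont'.halt⟩
  let M₁ := TM2to1.tr PartrecToTM2.tr
  let S := TM1to0.trStmts M₁ (TM2to1.trSupp PartrecToTM2.tr (codeSupp c Cont'.halt))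
  have hS : TM0.Supports (TM1to0.tr M₁) (S : Set (TM1to0.Λ' M₁)) :=
    TM1to0.tr_supports M₁ (TM2to1.tr_supports _ (PartrecToTM2.tr_supports c Cont'.halt))
  let : Inhabited (S : Set (TM1to0.Λ' M₁)) := ⟨⟨default, hS.1⟩⟩
  let f : Γ' → TM2to1.Γ' K' (fun _ => Γ') :=
    fun a => (false, Function.update (fun _ => none) K'.main (some a))
  let X : TM2to1.Γ' K' (fun _ => Γ') :=
    (true, Function.update (fun _ => none) K'.main (some Γ'.cons))
  have : Finite (TM2to1.Γ' K' (fun _ => Γ')) := by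
    unfold TM2to1.Γ'; infer_instance
  refine ⟨TM2to1.Γ' K' (fun _ => Γ'), (S : Set (TM1to0.Λ' M₁)), inferInstance, inferInstance,
    inferInstance, inferInstance, (TM1to0.tr M₁).restrict S hS, X, f Γ'.bit1, fun m => ?_⟩
  have hinit : TM2to1.trInit (Γ := fun _ : K' => Γ') K'.main (trList [2 ^ m - 1]) =
      X :: List.replicate m (f Γ'.bit1) := by
    rw [TM2to1.trInit, show (trList [2 ^ m - 1]).reverse =
      Γ'.cons :: List.replicate m Γ'.bit1 by simp [trList, trNat_two_pow_sub_one]]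
    change X :: (List.replicate m Γ'.bit1).map f = _
    rw [List.map_replicate]
  have h2 : (TM2.init K'.main (trList [2 ^ m - 1]) : TM2.Cfg (fun _ : K' => Γ') Λ' (Option Γ')) =
      PartrecToTM2.init c [2 ^ m - 1] := by
    unfold TM2.init PartrecToTM2.init
    congr 1
    funext k
    cases k <;> rfl
  have e₁ := tr_eval_dom (TM0.restrict_respects (TM1to0.tr M₁) S hS)
    (a₁ := TM0.init (X :: List.replicate m (f Γ'.bit1)))
    (a₂ := TM0.init (X :: List.replicate m (f Γ'.bit1))) ⟨rfl, rfl⟩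
  have e₂ := tr_eval_dom (TM1to0.tr_respects M₁)
    (a₁ := TM1.init (X :: List.replicate m (f Γ'.bit1)))
    (a₂ := TM0.init (X :: List.replicate m (f Γ'.bit1))) rfl
  have e₃ := tr_eval_dom (TM2to1.tr_respects PartrecToTM2.tr)
    (TM2to1.trCfg_init K'.main (trList [2 ^ m - 1]))
  rw [hinit, h2, PartrecToTM2.tr_eval] at e₃
  exact e₁.trans (e₂.trans e₃)

/-- A partial recursive function whose domain, sampled at the numbers `2 ^ (n + 1) - 1`, is
undecidable. -/
theorem exists_partrec_undecidable_dom :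
    ∃ g : ℕ →. ℕ, Partrec g ∧ ¬ ComputablePred fun n : ℕ => (g (2 ^ (n + 1) - 1)).Dom := by
  let f : ℕ →. ℕ := fun n => (Denumerable.ofNat Nat.Partrec.Code n).eval 0
  have hf : Partrec f := Nat.Partrec.Code.eval_part.comp (Computable.ofNat _) (Computable.const 0)
  -- An inverse of `n ↦ 2 ^ (n + 1) - 1`, found by unbounded search; composed with `f` it moves the
  -- halting problem to the sampled numbers.
  let s : ℕ →. ℕ := fun x => Nat.rfind fun n => (decide (2 ^ (n + 1) - 1 = x) : Bool)
  have hs : Partrec s := by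
    have hpow : Primrec fun n : ℕ => 2 ^ (n + 1) - 1 := by
      have h : Primrec fun n : ℕ => 2 ^ n := by
        refine (Primrec.nat_rec₁ (f := fun _ r => 2 * r) 1
          (Primrec.nat_mul.comp (Primrec.const 2) Primrec.snd)).of_eq fun n => ?_
        induction n with
        | zero => rfl
        | succ n ih => simp only [ih, pow_succ]; ring
      exact Primrec.nat_sub.comp (h.comp Primrec.succ) (Primrec.const 1)
    have : Primrec₂ fun x n : ℕ => (decide (2 ^ (n + 1) - 1 = x) : Bool) :=
      (Primrec.eq (α := ℕ)).decide.comp₂ (hpow.comp Primrec.snd).to₂ Primrec.fst.to₂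
    exact Partrec.rfind this.to_comp.partrec₂
  refine ⟨fun x => (s x).bind f, hs.bind (hf.comp Computable.snd), fun h => ?_⟩
  have key : ∀ n, s (2 ^ (n + 1) - 1) = Part.some n := by
    intro n
    refine Part.eq_some_iff.2 (Nat.mem_rfind.2 ⟨by simp, fun {m} hm => ?_⟩)
    have h1 : 2 ^ (m + 1) < 2 ^ (n + 1) := Nat.pow_lt_pow_right (by norm_num) (by omega)
    have h2 : 1 ≤ 2 ^ (m + 1) := Nat.one_le_two_pow
    simp only [Part.coe_some, Part.mem_some_iff, Bool.false_eq, decide_eq_false_iff_not]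
    omega
  simp only [key] at h
  refine ComputablePred.halting_problem 0 ?_
  refine ComputablePred.computable_of_manyOneReducible ⟨Encodable.encode, Computable.encode, ?_⟩ h
  intro c
  simp [f]

/-- There is a finite Turing machine whose halting problem is undecidable already for the inputs
that consist of a fixed symbol followed by copies of another one. -/
theorem exists_TM0_undecidable :
    ∃ (Γ Λ : Type) (_ : Inhabited Γ) (_ : Inhabited Λ) (_ : Finite Γ) (_ : Finite Λ)
      (M : TM0.Machine Γ Λ) (X Y : Γ), ¬ ComputablePred fun n : ℕ =>
        (eval (TM0.step M) (TM0.init (X :: List.replicate (n + 1) Y))).Dom := by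
  obtain ⟨g, hg, hdom⟩ := exists_partrec_undecidable_dom
  obtain ⟨c, hc⟩ := ToPartrec.Code.exists_code (Nat.Partrec'.part_iff₁.2 hg)
  obtain ⟨Γ, Λ, i₁, i₂, i₃, i₄, M, X, Y, h⟩ := exists_finite_TM0 c
  refine ⟨Γ, Λ, i₁, i₂, i₃, i₄, M, X, Y, fun hcomp => hdom ?_⟩
  refine hcomp.of_eq fun n => ?_
  rw [h]
  have := hc ⟨[2 ^ (n + 1) - 1], rfl⟩
  rw [show c.eval [2 ^ (n + 1) - 1] = _ from this]
  rfl

end Turing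

/-! ### An automaton that compares its input with a shifted copy of itself

The existential player has to recite the input. Whether the recital starts at once or after a
first block of the input is decided by a private move of the universal player, so both recitals
have to be the same. -/

/-- The moves of a game with the successors renamed. -/
def LabelledMove.map {L α β : Type} (e : α ↪ β) : LabelledMove L α → LabelledMove L β
  | .single t => .single (e t)
  | .choice f => .choice (f.trans e)

namespace PAFA

/-- The left end-marker occupies levels 0 and 1, so the letter after `u` is scanned from level `2 *
u.length + 2` on. Recitals happen one level earlier, and the recited letter is stored in the common
component until the comparison. -/
theorem scanned_append {A : Type} (u v : List A) :
    scanned (u ++ v) (2 * u.length + 2) = v.head? := by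
  have h : (2 * u.length + 2) / 2 = u.length + 1 := by omega
  rw [scanned, tape, h, List.getD_cons_succ]
  cases v <;> simp [List.getD_eq_getElem?_getD]

theorem depth_eq {A : Type} (w : List A) : depth w = 2 * w.length + 4 := by
  simp [depth, tape]; ring

variable {C P G D : Type}

theorem publicMoves_cons_none (s : C × P) (N : Node C P G D) :
    publicMoves ((none, s) :: N) = publicMoves N := by
  simp [publicMoves, publicLabel]

theorem publicMoves_cons_inl (g : G) (s : C × P) (N : Node C P G D) :
    publicMoves ((some (.inl g), s) :: N) = publicMoves N ++ [g] := by
  simp [publicMoves, publicLabel]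

theorem publicMoves_cons_inr (d : D) (s : C × P) (N : Node C P G D) :
    publicMoves ((some (.inr d), s) :: N) = publicMoves N := by
  simp [publicMoves, publicLabel]

end PAFA

/-- Local conditions on a word over `B`: `hor` relates a letter to its predecessor, `ver` relates
letters at a distance that is the length of the first block of the word, `goal` holds for some
letter behind the first block. The first block is recognized by a deterministic automaton with
state set `W`, which stops (`some none`), fails (`none`) or continues after each letter. -/
structure Checker (B W : Type) where
  hor : Option B → B → Bool
  ver : B → B → Bool
  goal : B → Bool
  wait₀ : W
  wait : W → B → Option (Option W)

/-- The private modes other than the states of the automaton for the first block. -/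
inductive Ctrl (B : Type) : Type
  | start
  | dead
  | eq (prev : Option B)
  | check (found : Bool)

namespace Checker

variable {B W : Type}

/-- The private state components. -/
abbrev Mode (B W : Type) : Type := Ctrl B ⊕ W

variable (S : Checker B W)

/-- Every letter of the word is compatible with its predecessor. -/
def EqRun : Option B → List B → Prop
  | _, [] => True
  | p, a :: w => S.hor p a = true ∧ EqRun (some a) w

/-- The letters of the second word are compatible with those of the first one, and one of them
reaches the goal. -/
def CheckRun : Bool → List B → List B → Prop
  | f, _, [] => f = true
  | _, [], _ :: _ => False
  | f, g :: y, a :: v => S.ver g a = true ∧ CheckRun (f || S.goal a) y v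

/-- The automaton for the first block stops on a prefix of the word, the rest of which is
compatible with `w`. -/
def WaitRun (w : List B) : W → List B → Prop
  | _, [] => False
  | q, a :: v =>
    match S.wait q a with
    | none => False
    | some none => S.CheckRun false w v
    | some (some q') => WaitRun w q' v

/-- The word satisfies all conditions. -/
def Accepts (w : List B) : Prop :=
  S.EqRun none w ∧ S.WaitRun w S.wait₀ w

/-- The state is one of the universal player. -/
def universal (c : Option B) : Mode B W → Bool
  | .inl (.eq _) => c.isSome
  | .inl (.check _) => c.isSome
  | _ => true

variable [DecidableEq B] (g₀ : B)

/-- The successor of a universal state other than the initial one. -/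
def next : Option B → Mode B W → Option B → Option B × Mode B W
  -- With a letter as common component, `start` is a winning sink: it moves to the accepting
  -- component `some g₀` and stays there.
  | some _, .inl .start, _ => (some g₀, .inl .start)
  | some g, .inl (.eq p), some a =>
    if a = g ∧ S.hor p a = true then (none, .inl (.eq (some a))) else (none, .inl .dead)
  | some _, .inl (.eq _), none => (some g₀, .inl .start)
  | some g, .inl (.check f), some a =>
    if S.ver g a = true then (none, .inl (.check (f || S.goal a))) else (none, .inl .dead)
  | some _, .inl (.check true), none => (some g₀, .inl .start)
  -- A dummy step in place of a recital, so that waiting also reads one letter per two levels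
  -- without any public move.
  | none, .inr q, _ => (some g₀, .inr q)
  | some _, .inr q, some a =>
    match S.wait q a with
    | none => (none, .inl .dead)
    | some none => (none, .inl (.check false))
    | some (some q') => (none, .inr q')
  | _, _, _ => (none, .inl .dead)

/-- The initial choice of the universal player. -/
def openings : B ⊕ Fin 2 ↪ Option B × Mode B W where
  toFun
    -- A choice must also offer all public labels, with the private component unchanged; these
    -- branches are simply won.
    | .inl g => (some g, .inl .start)
    | .inr 0 => (none, .inl (.eq none))
    | .inr 1 => (none, .inr S.wait₀)
  inj' := by
    rintro (g | d) (g' | d') h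
    · simpa using h
    · fin_cases d' <;> simp at h
    · fin_cases d <;> simp at h
    · fin_cases d <;> fin_cases d' <;> simp at h ⊢

/-- The universal transition function. -/
def move : Option B → Mode B W → Option B → LabelledMove (B ⊕ Fin 2) (Option B × Mode B W)
  | none, .inl .start, _ => .choice S.openings
  | c, m, a => .single (S.next g₀ c m a)

/-- The modes in which the existential player recites. -/
def Reciting : Mode B W → Prop
  | .inl (.eq _) => True
  | .inl (.check _) => True
  | _ => False

variable {C P : Type} [Finite C] [Finite P] [Finite B] [Nontrivial B]
  (eC : C ≃ Option B) (eP : P ≃ Mode B W)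

/-- The automaton for the given conditions, with arbitrary names for its states. -/
def pafa : PAFA C P B B (Fin 2) where
  isUniversal c p := universal (eC c) (eP p)
  deltaE c :=
    match eC c with
    | none => .choice (Function.Embedding.some.trans eC.symm.toEmbedding)
    -- A dummy value: all states with such a common component are universal.
    | some _ => .single c
  deltaU c p a := (S.move g₀ (eC c) (eP p) a).map (eC.prodCongr eP).symm.toEmbedding
  initC := eC.symm none
  initP := eP.symm (.inl .start)
  accept := eC.symm (some g₀)
  reject := eC.symm none
  public_nontrivial := inferInstance
  private_nontrivial := inferInstance
  public_move := by
    intro c p a f hf g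
    obtain ⟨c, rfl⟩ := eC.symm.surjective c
    obtain ⟨m, rfl⟩ := eP.symm.surjective p
    simp only [Equiv.apply_symm_apply] at hf
    rcases c with _ | c <;> rcases m with (_ | _ | _ | _) | _ <;>
      simp only [move, LabelledMove.map, reduceCtorEq, LabelledMove.choice.injEq] at hf
    subst hf
    rfl

/-- The name of a state. -/
def enc (s : Option B × Mode B W) : C × P := (eC.prodCongr eP).symm s

variable {S g₀ eC eP}

local notation "𝓜" => S.pafa g₀ eC eP

theorem isUniversal_enc (c : Option B) (m : Mode B W) :
    (𝓜).isUniversal (enc eC eP (c, m)).1 (enc eC eP (c, m)).2 = universal c m := by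
  simp [pafa, enc]

theorem step_recite {m : Mode B W} (hm : Reciting m) (a : Option B) (e : PAFA.Edge C P B (Fin 2)) :
    (𝓜).Step (enc eC eP (none, m)) a e ↔
      ∃ g : B, e = (some (.inl g), enc eC eP (some g, m)) := by
  have h : universal (none : Option B) m = false := by
    rcases m with (_ | _ | _ | _) | _ <;> simp_all [universal, Reciting]
  simp only [PAFA.Step, isUniversal_enc, h]
  simp [pafa, enc]

theorem step_start (a : Option B) (e : PAFA.Edge C P B (Fin 2)) :
    (𝓜).Step (enc eC eP (none, .inl .start)) a e ↔
      ∃ l : B ⊕ Fin 2, e = (some l, enc eC eP (S.openings l)) := by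
  simp only [PAFA.Step, isUniversal_enc, universal]
  simp [pafa, enc, move, LabelledMove.map]

theorem step_next {c : Option B} {m : Mode B W} (hu : universal c m = true)
    (hs : (c, m) ≠ (none, .inl .start)) (a : Option B) (e : PAFA.Edge C P B (Fin 2)) :
    (𝓜).Step (enc eC eP (c, m)) a e ↔ e = (none, enc eC eP (S.next g₀ c m a)) := by
  have h : S.move g₀ c m a = .single (S.next g₀ c m a) := by
    rcases c with _ | c <;> rcases m with (_ | _ | _ | _) | _ <;> simp_all [move]
  simp only [PAFA.Step, isUniversal_enc, hu]
  simp [pafa, enc, h, LabelledMove.map]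

/-! ### Words in the language satisfy the conditions -/

section Sound

variable {w : List B} {T : Set (PAFA.Node C P B (Fin 2))}

theorem next_mem (hT : (𝓜).IsAcceptingSubtree w T) {N : PAFA.Node C P B (Fin 2)} (hN : N ∈ T)
    (hl : N.length < PAFA.depth w) {c : Option B} {m : Mode B W}
    (hs : (𝓜).state N = enc eC eP (c, m)) (hu : universal c m = true)
    (hne : (c, m) ≠ (none, .inl .start)) :
    (none, enc eC eP (S.next g₀ c m (PAFA.scanned w N.length))) :: N ∈ T := by
  refine hT.universal N hN ?_ _ (.child _ _ (hT.subset N hN) hl ?_)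
  · rw [PAFA.IsUniversalNode, hs, isUniversal_enc, hu]
  · rw [hs, step_next hu hne]

theorem recite_mem (hT : (𝓜).IsAcceptingSubtree w T) {N : PAFA.Node C P B (Fin 2)} (hN : N ∈ T)
    (hl : N.length < PAFA.depth w) {m : Mode B W}
    (hs : (𝓜).state N = enc eC eP (none, m)) (hm : Reciting m) :
    ¬ (𝓜).IsUniversalNode N ∧
      ∃ g : B, (some (.inl g), enc eC eP (some g, m)) :: N ∈ T := by
  have hu : ¬ (𝓜).IsUniversalNode N := by
    rw [PAFA.IsUniversalNode, hs, isUniversal_enc]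
    rcases m with (_ | _ | _ | _) | _ <;> simp_all [universal, Reciting]
  refine ⟨hu, ?_⟩
  obtain ⟨e, he, -⟩ := hT.existential N hN hl hu
  cases hT.subset _ he with
  | child _ _ _ _ hstep =>
    rw [hs, step_recite hm] at hstep
    obtain ⟨g, rfl⟩ := hstep
    exact ⟨g, he⟩

/-- The dead mode is absorbing, and its common component is not the accepting one; `k` counts the
levels left until a leaf shows this. -/
theorem dead_notMem (hT : (𝓜).IsAcceptingSubtree w T) (k : ℕ) {N : PAFA.Node C P B (Fin 2)}
    (hN : N ∈ T) (hl : N.length + k = PAFA.depth w)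
    (hs : (𝓜).state N = enc eC eP (none, .inl .dead)) : False := by
  induction k generalizing N with
  | zero =>
    have := hT.leaf N hN hl
    rw [hs] at this
    simp [enc, pafa] at this
  | succ k ih =>
    have := next_mem hT hN (by omega) hs rfl (by simp)
    exact ih this (by simp only [List.length_cons]; omega) (by simp [PAFA.state, next])

/-- Every recital in the tree continues `u` by `a`. -/
def Forced (M : PAFA C P B B (Fin 2)) (T : Set (PAFA.Node C P B (Fin 2))) (c : C) (u : List B)
    (a : B) : Prop :=
  ∀ N e, e :: N ∈ T → ¬ M.IsUniversalNode N → (M.state N).1 = c → PAFA.publicMoves N = u →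
    e.1 = some (.inl a)

/-- On this branch a recited letter that differs from the scanned one leads to the dead mode, so the
recital is the input. Privacy then imposes the same letter on every existential node of `T` with the
same common component and public moves, which is the second half of the conclusion. -/
theorem eqRun_of_mem (hT : (𝓜).IsAcceptingSubtree w T) (v u : List B) (hw : w = u ++ v)
    (p : Option B) {N : PAFA.Node C P B (Fin 2)} (hN : N ∈ T) (hl : N.length = 2 * u.length + 1)
    (hs : (𝓜).state N = enc eC eP (none, .inl (.eq p))) (hp : PAFA.publicMoves N = u) :
    S.EqRun p v ∧ ∀ v₁ a v₂, v = v₁ ++ a :: v₂ → Forced (𝓜) T (eC.symm none) (u ++ v₁) a := by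
  induction v generalizing u p N with
  | nil => exact ⟨trivial, fun v₁ a v₂ h => by simp at h⟩
  | cons a v ih =>
    have hd : PAFA.depth w = 2 * u.length + 2 * v.length + 6 := by
      rw [PAFA.depth_eq, hw]; simp; ring
    obtain ⟨hu, g, hg⟩ := recite_mem hT hN (by omega) hs trivial
    have h₁ := next_mem hT hg (by simp only [List.length_cons]; omega) rfl rfl (by simp)
    have hsc : PAFA.scanned w ((some (.inl g), enc eC eP (some g, .inl (.eq p))) :: N).length
        = some a := by
      rw [List.length_cons, hl, hw, PAFA.scanned_append]; rfl
    rw [hsc] at h₁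
    by_cases hag : a = g ∧ S.hor p a = true
    · rw [next, if_pos hag] at h₁
      obtain ⟨rfl, hhor⟩ := hag
      obtain ⟨r₁, r₂⟩ := ih (u ++ [a]) (by simp [hw]) (some a) h₁ (by simp [hl]; ring) rfl
        (by simp only [PAFA.publicMoves_cons_none, PAFA.publicMoves_cons_inl, hp])
      refine ⟨⟨hhor, r₁⟩, fun v₁ b v₂ h => ?_⟩
      cases v₁ with
      | nil =>
        simp only [List.nil_append, List.cons.injEq] at h
        obtain ⟨rfl, -⟩ := h
        intro N' e' he' hu' hc' hp'
        refine hT.privacy _ _ _ _ he' hg hu' hu ?_ ?_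
        · rw [hc', hs]; rfl
        · rw [hp', hp, List.append_nil]
      | cons b' v₁ =>
        simp only [List.cons_append, List.cons.injEq] at h
        obtain ⟨rfl, h⟩ := h
        simpa using r₂ v₁ b v₂ h
    · simp only [next, hag, if_false] at h₁
      exact (dead_notMem hT (PAFA.depth w - (2 * u.length + 3)) h₁ (by simp [hl]; omega) rfl).elim

/-- Here `u` is the part already read and `x` the part already recited, both prefixes of `w`. By
`hF` the next recited letter is the head of `y`, so it is compared with the head of `v`; `hlen`
ensures that the recital does not run out of letters first. -/
theorem checkRun_of_mem (hT : (𝓜).IsAcceptingSubtree w T)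
    (hF : ∀ v₁ a v₂, w = v₁ ++ a :: v₂ → Forced (𝓜) T (eC.symm none) v₁ a)
    (v u x y : List B) (hw : w = u ++ v) (hxy : w = x ++ y) (hlen : v.length ≤ y.length)
    (f : Bool) {N : PAFA.Node C P B (Fin 2)} (hN : N ∈ T) (hl : N.length = 2 * u.length + 1)
    (hs : (𝓜).state N = enc eC eP (none, .inl (.check f))) (hp : PAFA.publicMoves N = x) :
    S.CheckRun f y v := by
  induction v generalizing u x y f N with
  | nil =>
    have hd : PAFA.depth w = 2 * u.length + 4 := by
      rw [PAFA.depth_eq, hw]; simp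
    obtain ⟨hu, g, hg⟩ := recite_mem hT hN (by omega) hs trivial
    have h₁ := next_mem hT hg (by simp only [List.length_cons]; omega) rfl rfl (by simp)
    have hsc : PAFA.scanned w ((some (.inl g), enc eC eP (some g, .inl (.check f))) :: N).length
        = none := by
      rw [List.length_cons, hl, hw, PAFA.scanned_append]; rfl
    rw [hsc] at h₁
    cases f with
    | true => rw [CheckRun]
    | false => exact (dead_notMem hT 1 h₁ (by simp [hl]; omega) rfl).elim
  | cons a v ih =>
    have hd : PAFA.depth w = 2 * u.length + 2 * v.length + 6 := by
      rw [PAFA.depth_eq, hw]; simp; ring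
    cases y with
    | nil => simp at hlen
    | cons b y =>
      obtain ⟨hu, g, hg⟩ := recite_mem hT hN (by omega) hs trivial
      have hgb : g = b := by
        have := hF x b y hxy N _ hg hu (by rw [hs]; rfl) hp
        simpa using this
      subst hgb
      have h₁ := next_mem hT hg (by simp only [List.length_cons]; omega) rfl rfl (by simp)
      have hsc : PAFA.scanned w ((some (.inl g), enc eC eP (some g, .inl (.check f))) :: N).length
          = some a := by
        rw [List.length_cons, hl, hw, PAFA.scanned_append]; rfl
      rw [hsc] at h₁
      by_cases hv : S.ver g a = true
      · simp only [next, hv, if_true] at h₁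
        exact ⟨hv, ih (u ++ [a]) (x ++ [g]) y (by simp [hw]) (by simp [hxy]) (by simpa using hlen)
          _ h₁ (by simp [hl]; ring) rfl
          (by simp only [PAFA.publicMoves_cons_none, PAFA.publicMoves_cons_inl, hp])⟩
      · simp only [next, hv] at h₁
        exact (dead_notMem hT (PAFA.depth w - (2 * u.length + 3)) h₁ (by simp [hl]; omega)
          rfl).elim

/-- Waiting makes only unlabelled moves, so the public moves are still empty when the first block
ends and the recital starts from the first letter of `w`. -/
theorem waitRun_of_mem (hT : (𝓜).IsAcceptingSubtree w T)
    (hF : ∀ v₁ a v₂, w = v₁ ++ a :: v₂ → Forced (𝓜) T (eC.symm none) v₁ a)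
    (v u : List B) (hw : w = u ++ v) (q : W) {N : PAFA.Node C P B (Fin 2)} (hN : N ∈ T)
    (hl : N.length = 2 * u.length + 1) (hs : (𝓜).state N = enc eC eP (none, .inr q))
    (hp : PAFA.publicMoves N = []) : S.WaitRun w q v := by
  induction v generalizing u q N with
  | nil =>
    have hd : PAFA.depth w = 2 * u.length + 4 := by
      rw [PAFA.depth_eq, hw]; simp
    have h₀ := next_mem hT hN (by omega) hs rfl (by simp)
    have h₁ := next_mem hT h₀ (by simp only [List.length_cons]; omega) rfl rfl (by simp)
    have hsc : PAFA.scanned w (N.length + 1) = none := by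
      rw [hl, hw, PAFA.scanned_append]; rfl
    simp only [List.length_cons, hsc] at h₁
    exact (dead_notMem hT 1 h₁ (by simp [hl]; omega) rfl).elim
  | cons a v ih =>
    have hd : PAFA.depth w = 2 * u.length + 2 * v.length + 6 := by
      rw [PAFA.depth_eq, hw]; simp; ring
    have h₀ := next_mem hT hN (by omega) hs rfl (by simp)
    have h₁ := next_mem hT h₀ (by simp only [List.length_cons]; omega) rfl rfl (by simp)
    have hsc : PAFA.scanned w (N.length + 1) = some a := by
      rw [hl, hw, PAFA.scanned_append]; rfl
    simp only [List.length_cons, hsc] at h₁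
    rw [WaitRun]
    rcases hq : S.wait q a with _ | _ | q'
    · simp only [next, hq] at h₁
      exact (dead_notMem hT (PAFA.depth w - (2 * u.length + 3)) h₁ (by simp [hl]; omega) rfl).elim
    · simp only [next, hq] at h₁
      exact checkRun_of_mem hT hF v (u ++ [a]) [] w (by simp [hw]) rfl (by simp [hw]; omega) false
        h₁ (by simp [hl]; ring) rfl (by simp only [PAFA.publicMoves_cons_none, hp])
    · simp only [next, hq] at h₁
      exact ih (u ++ [a]) (by simp [hw]) q' h₁ (by simp [hl]; ring) rfl
        (by simp only [PAFA.publicMoves_cons_none, hp])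

theorem accepts_of_mem_language (h : w ∈ (𝓜).language) : S.Accepts w := by
  obtain ⟨T, hT⟩ := h
  have hopen : ∀ l : B ⊕ Fin 2, [(some l, enc eC eP (S.openings l))] ∈ T := by
    intro l
    refine hT.universal [] hT.root_mem ?_ _ (.child _ _ .root (by rw [PAFA.depth_eq]; simp) ?_)
    · exact isUniversal_enc none (.inl .start)
    · exact (step_start _ _).2 ⟨l, rfl⟩
  obtain ⟨h₁, h₂⟩ := eqRun_of_mem hT w [] rfl none (hopen (.inr 0)) rfl rfl rfl
  exact ⟨h₁, waitRun_of_mem hT h₂ w [] rfl S.wait₀ (hopen (.inr 1)) rfl rfl rfl⟩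

end Sound

/-! ### Words that satisfy the conditions are in the language -/

section Complete

/-- The nodes in which the existential player has recited `w`. -/
inductive Follows (M : PAFA C P B B (Fin 2)) (w : List B) (σ : List B → B) :
    PAFA.Node C P B (Fin 2) → Prop
  | root : Follows M w σ []
  | child (N : PAFA.Node C P B (Fin 2)) (e : PAFA.Edge C P B (Fin 2)) : Follows M w σ N →
      N.length < PAFA.depth w → M.Step (M.state N) (PAFA.scanned w N.length) e →
      (¬ M.IsUniversalNode N → e.1 = some (.inl (σ (PAFA.publicMoves N)))) →
      Follows M w σ (e :: N)

/-- The situations that may arise, at the given levels and with the given public moves, when the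
existential player recites a word `w` that satisfies the conditions. -/
inductive Situation (S : Checker B W) (g₀ : B) (w : List B) :
    Option B × Mode B W → ℕ → List B → Prop
  | start : Situation S g₀ w (none, .inl .start) 0 []
  | opened (g : B) (x : List B) : Situation S g₀ w (some g, .inl .start) 1 x
  | won (n : ℕ) (x : List B) : Situation S g₀ w (some g₀, .inl .start) n x
  | eq (u v : List B) (p : Option B) (hw : w = u ++ v) (h : S.EqRun p v) :
      Situation S g₀ w (none, .inl (.eq p)) (2 * u.length + 1) u
  | eqTold (u v : List B) (p : Option B) (hw : w = u ++ v) (h : S.EqRun p v) :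
      Situation S g₀ w (some (v.headD g₀), .inl (.eq p)) (2 * u.length + 2) (u ++ [v.headD g₀])
  | check (u v x y : List B) (f : Bool) (hw : w = u ++ v) (hxy : w = x ++ y)
      (h : S.CheckRun f y v) : Situation S g₀ w (none, .inl (.check f)) (2 * u.length + 1) x
  | checkTold (u v x y : List B) (f : Bool) (hw : w = u ++ v) (hxy : w = x ++ y)
      (h : S.CheckRun f y v) :
      Situation S g₀ w (some (y.headD g₀), .inl (.check f)) (2 * u.length + 2) (x ++ [y.headD g₀])
  | wait (u v : List B) (q : W) (hw : w = u ++ v) (h : S.WaitRun w q v) :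
      Situation S g₀ w (none, .inr q) (2 * u.length + 1) []
  | waitTold (u v : List B) (q : W) (hw : w = u ++ v) (h : S.WaitRun w q v) :
      Situation S g₀ w (some g₀, .inr q) (2 * u.length + 2) []

/-- The situations are closed under all moves of the universal player and under the existential
strategy, which recites the letter of `w` whose index is the number of public moves seen. -/
theorem Follows.situation {w : List B} (hw : S.Accepts w) {N : PAFA.Node C P B (Fin 2)}
    (hN : Follows (𝓜) w (fun x => (w.drop x.length).headD g₀) N) :
    ∃ s, (𝓜).state N = enc eC eP s ∧ Situation S g₀ w s N.length (PAFA.publicMoves N) := by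
  induction hN with
  | root => exact ⟨_, rfl, .start⟩
  | child N e _ hl hstep hrec ih =>
    obtain ⟨s, hs, hsit⟩ := ih
    rw [hs] at hstep
    rw [PAFA.IsUniversalNode, hs, isUniversal_enc] at hrec
    rw [List.length_cons]
    generalize hn : List.length N = n at hsit hl hstep
    generalize hx : PAFA.publicMoves N = x at hsit hrec
    cases hsit with
    | start =>
      rw [step_start] at hstep
      obtain ⟨l, rfl⟩ := hstep
      refine ⟨_, rfl, ?_⟩
      rcases l with g | d
      · exact .opened _ _
      · rw [PAFA.publicMoves_cons_inr, hx]
        fin_cases d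
        · exact .eq [] w none rfl hw.1
        · exact .wait [] w _ rfl hw.2
    | opened g x =>
      rw [step_next rfl (by simp)] at hstep
      subst hstep
      exact ⟨_, rfl, .won _ _⟩
    | won n x =>
      rw [step_next rfl (by simp)] at hstep
      subst hstep
      exact ⟨_, rfl, .won _ _⟩
    | eq _ v p hw h =>
      rw [step_recite (m := .inl (.eq p)) trivial] at hstep
      obtain ⟨g, rfl⟩ := hstep
      have hg : g = v.headD g₀ := by simpa [universal, hw] using hrec
      subst hg
      refine ⟨_, rfl, ?_⟩
      rw [PAFA.publicMoves_cons_inl, hx]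
      exact .eqTold x v p hw h
    | eqTold u v p hw h =>
      rw [step_next rfl (by simp), hw, PAFA.scanned_append] at hstep
      subst hstep
      refine ⟨_, rfl, ?_⟩
      rw [PAFA.publicMoves_cons_none, hx]
      cases v with
      | nil => exact .won _ _
      | cons a v =>
        obtain ⟨h₁, h₂⟩ := h
        simp only [List.head?_cons, List.headD_cons, next, h₁, and_self, if_true]
        rw [show 2 * u.length + 2 + 1 = 2 * (u ++ [a]).length + 1 by simp; ring]
        exact .eq (u ++ [a]) v (some a) (by simp [hw]) h₂
    | check u v _ y f hw hxy h =>
      rw [step_recite (m := .inl (.check f)) trivial] at hstep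
      obtain ⟨g, rfl⟩ := hstep
      have hg : g = y.headD g₀ := by simpa [universal, hxy] using hrec
      subst hg
      refine ⟨_, rfl, ?_⟩
      rw [PAFA.publicMoves_cons_inl, hx]
      exact .checkTold u v x y f hw hxy h
    | checkTold u v x y f hw hxy h =>
      rw [step_next rfl (by simp), hw, PAFA.scanned_append] at hstep
      subst hstep
      refine ⟨_, rfl, ?_⟩
      rw [PAFA.publicMoves_cons_none, hx]
      cases v with
      | nil =>
        rw [CheckRun] at h
        subst h
        exact .won _ _
      | cons a v =>
        cases y with
        | nil => exact h.elim
        | cons g y =>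
          obtain ⟨h₁, h₂⟩ := h
          simp only [List.head?_cons, List.headD_cons, next, h₁, if_true]
          rw [show 2 * u.length + 2 + 1 = 2 * (u ++ [a]).length + 1 by simp; ring]
          exact .check (u ++ [a]) v (x ++ [g]) y _ (by simp [hw]) (by simp [hxy]) h₂
    | wait u v q hw h =>
      rw [step_next rfl (by simp)] at hstep
      subst hstep
      refine ⟨_, rfl, ?_⟩
      rw [PAFA.publicMoves_cons_none, hx]
      exact .waitTold u v q hw h
    | waitTold u v q hw h =>
      rw [step_next rfl (by simp), hw, PAFA.scanned_append] at hstep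
      subst hstep
      refine ⟨_, rfl, ?_⟩
      rw [PAFA.publicMoves_cons_none, hx]
      cases v with
      | nil => exact h.elim
      | cons a v =>
        have hlen : 2 * u.length + 2 + 1 = 2 * (u ++ [a]).length + 1 := by simp; ring
        rw [WaitRun] at h
        rw [hlen]
        rcases hq : S.wait q a with _ | _ | q'
        · simp [hq] at h
        · simp only [hq] at h
          simp only [List.head?_cons, next, hq]
          exact .check (u ++ [a]) v [] w false (by simp [hw]) rfl h
        · simp only [hq] at h
          simp only [List.head?_cons, next, hq]
          exact .wait (u ++ [a]) v q' (by simp [hw]) h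

theorem mem_language_of_accepts {w : List B} (hw : S.Accepts w) : w ∈ (𝓜).language := by
  -- The strategy depends on the public moves alone, so privacy is automatic. The default `g₀` is
  -- recited once the word is exhausted, as happens before the right end-marker is scanned.
  set σ : List B → B := fun x => (w.drop x.length).headD g₀ with hσ
  refine ⟨{N | Follows (𝓜) w σ N}, ?_, .root, ?_, ?_, ?_, ?_, ?_⟩
  · intro N hN
    induction hN with
    | root => exact .root
    | child N e _ hl hstep _ ih => exact .child N e ih hl hstep
  · intro N e h
    cases h with
    | child _ _ h _ _ _ => exact h
  · intro N hN hl hu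
    obtain ⟨⟨c, m⟩, hs, -⟩ := hN.situation hw
    have hu' := hu
    rw [PAFA.IsUniversalNode, hs, isUniversal_enc] at hu'
    have hc : c = none ∧ Reciting m := by
      rcases c with _ | c <;> rcases m with (_ | _ | _ | _) | _ <;>
        simp_all [universal, Reciting]
    obtain ⟨rfl, hm⟩ := hc
    refine ⟨(some (.inl (σ (PAFA.publicMoves N))), enc eC eP (some (σ (PAFA.publicMoves N)), m)),
      .child _ _ hN hl ?_ fun _ => rfl, ?_⟩
    · rw [hs, step_recite hm]
      exact ⟨_, rfl⟩
    · intro e he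
      cases he with
      | child _ _ _ _ hstep hrec =>
        rw [hs, step_recite hm] at hstep
        obtain ⟨g, rfl⟩ := hstep
        have := hrec hu
        simp only [Option.some.injEq, Sum.inl.injEq] at this
        rw [this]
  · intro N hN hu e he
    cases he with
    | child _ _ _ hl hstep => exact .child N e hN hl hstep fun h => (h hu).elim
  · intro N hN hl
    obtain ⟨s, hs, hsit⟩ := hN.situation hw
    rw [hl, PAFA.depth_eq] at hsit
    rw [hs]
    generalize hn : 2 * w.length + 4 = n at hsit
    generalize PAFA.publicMoves N = x at hsit
    -- All situations other than `won` live at levels at most `2 * w.length + 2`.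
    cases hsit with
    | won => rfl
    | _ => simp_all <;> omega
  · intro N₁ N₂ e₁ e₂ h₁ h₂ hu₁ hu₂ _ hp
    cases h₁ with
    | child _ _ _ _ _ hr₁ =>
      cases h₂ with
      | child _ _ _ _ _ hr₂ => rw [hr₁ hu₁, hr₂ hu₂, hp]

theorem mem_language_iff {w : List B} : w ∈ (𝓜).language ↔ S.Accepts w :=
  ⟨accepts_of_mem_language, mem_language_of_accepts⟩

end Complete

end Checker

/-! ### Computations of a Turing machine as words -/

open Turing StateTransition

/-- The letters `t i, …, t (i + n - 1)`. -/
def letters {B : Type} (t : ℕ → B) (i n : ℕ) : List B := (List.range' i n).map t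

theorem letters_succ {B : Type} (t : ℕ → B) (i n : ℕ) :
    letters t i (n + 1) = t i :: letters t (i + 1) n := by
  simp [letters, List.range'_succ]

theorem letters_getD {B : Type} (w : List B) (d : B) :
    letters (fun j => w.getD j d) 0 w.length = w := by
  refine List.ext_getElem (by simp [letters]) fun i h₁ h₂ => ?_
  simp [letters, h₂]

/-! ### Checker conditions in terms of indices -/

namespace Checker

variable {B W : Type} (S : Checker B W) (t : ℕ → B)

theorem eqRun_letters (p : Option B) (i n : ℕ) :
    S.EqRun p (letters t i n) ↔ (0 < n → S.hor p (t i) = true) ∧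
      ∀ j, i ≤ j → j + 1 < i + n → S.hor (some (t j)) (t (j + 1)) = true := by
  induction n generalizing p i with
  | zero =>
    simp only [letters, List.range'_zero, List.map_nil, EqRun, true_iff]
    exact ⟨fun h => by omega, fun j _ _ => by omega⟩
  | succ n ih =>
    rw [letters_succ, EqRun, ih]
    constructor
    · rintro ⟨h, h₁, h₂⟩
      refine ⟨fun _ => h, fun j hj hj' => ?_⟩
      rcases hj.eq_or_lt with rfl | hj
      · exact h₁ (by omega)
      · exact h₂ j hj (by omega)
    · rintro ⟨h₁, h₂⟩
      exact ⟨h₁ (by omega), fun _ => h₂ i le_rfl (by omega), fun j hj hj' => h₂ j (by omega)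
        (by omega)⟩

theorem checkRun_letters (f : Bool) (i n k m : ℕ) (hmn : m ≤ n) :
    S.CheckRun f (letters t i n) (letters t (k + i) m) ↔
      (∀ j, i ≤ j → j < i + m → S.ver (t j) (t (k + j)) = true) ∧
        (f = true ∨ ∃ j, i ≤ j ∧ j < i + m ∧ S.goal (t (k + j)) = true) := by
  induction m generalizing f i n with
  | zero =>
    simp only [letters, List.range'_zero, List.map_nil, CheckRun]
    constructor
    · exact fun h => ⟨fun j _ _ => by omega, .inl h⟩
    · rintro ⟨-, h | ⟨j, h₁, h₂, -⟩⟩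
      · exact h
      · omega
  | succ m ih =>
    obtain ⟨n, rfl⟩ : ∃ n', n = n' + 1 := ⟨n - 1, by omega⟩
    rw [letters_succ, letters_succ, CheckRun, add_assoc k i 1, ih _ _ _ (by omega)]
    constructor
    · rintro ⟨h, h₁, h₂⟩
      refine ⟨fun j hj hj' => ?_, ?_⟩
      · rcases hj.eq_or_lt with rfl | hj
        · exact h
        · exact h₁ j hj (by omega)
      · rcases h₂ with h₂ | ⟨j, hj, hj', h₂⟩
        · rcases Bool.or_eq_true_iff.1 h₂ with h₂ | h₂
          · exact .inl h₂
          · exact .inr ⟨i, le_rfl, by omega, h₂⟩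
        · exact .inr ⟨j, by omega, by omega, h₂⟩
    · rintro ⟨h₁, h₂⟩
      refine ⟨h₁ i le_rfl (by omega), fun j hj hj' => h₁ j (by omega) (by omega), ?_⟩
      rcases h₂ with h₂ | ⟨j, hj, hj', h₂⟩
      · exact .inl (by simp [h₂])
      · rcases hj.eq_or_lt with rfl | hj
        · exact .inl (by simp [h₂])
        · exact .inr ⟨j, hj, by omega, h₂⟩

end Checker

/-! ### Configurations in fixed coordinates and the local update rule -/

namespace Turing.TM0

variable {Γ Λ : Type} [Inhabited Γ] [Inhabited Λ]

/-- A cell of a row: `none` is a separator, otherwise there is a symbol and possibly the head with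
its state. -/
abbrev Cell (Γ Λ : Type) : Type := Option (Γ × Option Λ)

/-- A configuration with the position of the head. -/
abbrev PosCfg (Γ Λ : Type) [Inhabited Γ] : Type := Cfg Γ Λ × ℤ

variable (M : Machine Γ Λ)

/-- The step function, which leaves halted configurations unchanged. -/
def posStep (p : PosCfg Γ Λ) : PosCfg Γ Λ :=
  match M p.1.q p.1.Tape.head with
  | none => p
  | some (q, .write a) => (⟨q, p.1.Tape.write a⟩, p.2)
  | some (q, .move .right) => (⟨q, p.1.Tape.move .right⟩, p.2 + 1)
  | some (q, .move .left) => (⟨q, p.1.Tape.move .left⟩, p.2 - 1)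

theorem posStep_fst (p : PosCfg Γ Λ) : (posStep M p).1 = (step M p.1).getD p.1 := by
  obtain ⟨⟨q, T⟩, h⟩ := p
  simp only [posStep, step]
  rcases M q T.head with _ | ⟨q', (_ | _) | a⟩ <;> rfl

theorem abs_posStep_snd_le (p : PosCfg Γ Λ) : |(posStep M p).2 - p.2| ≤ 1 := by
  obtain ⟨⟨q, T⟩, h⟩ := p
  simp only [posStep]
  rcases M q T.head with _ | ⟨q', (_ | _) | a⟩ <;> simp

/-- Bounds the row width that a computation of `r` steps requires. -/
theorem abs_iterate_posStep_snd_le (p : PosCfg Γ Λ) (r : ℕ) :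
    |((posStep M)^[r] p).2 - p.2| ≤ r := by
  induction r with
  | zero => simp
  | succ r ih =>
    rw [Function.iterate_succ_apply']
    have := abs_posStep_snd_le M ((posStep M)^[r] p)
    rw [abs_le] at *
    push_cast
    constructor <;> linarith [this.1, this.2, ih.1, ih.2]

theorem reaches_iterate_posStep (p : PosCfg Γ Λ) (r : ℕ) :
    Relation.ReflTransGen (fun a b => b ∈ step M a) p.1 ((posStep M)^[r] p).1 := by
  induction r with
  | zero => exact .refl
  | succ r ih =>
    rw [Function.iterate_succ_apply', posStep_fst]
    cases h : step M ((posStep M)^[r] p).1 with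
    | none => exact ih
    | some c => exact ih.tail h

theorem exists_iterate_posStep {c : Cfg Γ Λ} (p : PosCfg Γ Λ)
    (h : Relation.ReflTransGen (fun a b => b ∈ step M a) p.1 c) :
    ∃ r, ((posStep M)^[r] p).1 = c := by
  induction h with
  | refl => exact ⟨0, rfl⟩
  | tail _ h ih =>
    obtain ⟨r, rfl⟩ := ih
    refine ⟨r + 1, ?_⟩
    rw [Function.iterate_succ_apply', posStep_fst, Option.mem_def.1 h]
    rfl

/-- Since `posStep` idles on halted configurations, its iterates run through exactly the
configurations reachable by `step`. -/
theorem eval_dom_iff (p : PosCfg Γ Λ) :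
    (StateTransition.eval (step M) p.1).Dom ↔ ∃ r, step M ((posStep M)^[r] p).1 = none := by
  rw [Part.dom_iff_mem]
  constructor
  · rintro ⟨c, hc⟩
    obtain ⟨h₁, h₂⟩ := mem_eval.1 hc
    obtain ⟨r, rfl⟩ := exists_iterate_posStep M p h₁
    exact ⟨r, h₂⟩
  · rintro ⟨r, hr⟩
    exact ⟨_, mem_eval.2 ⟨reaches_iterate_posStep M p r, hr⟩⟩

theorem step_eq_none_iff (c : Cfg Γ Λ) : step M c = none ↔ M c.q c.Tape.head = none := by
  simp [step]

/-- The cell at position `i`. -/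
noncomputable def cellAt (p : PosCfg Γ Λ) (i : ℤ) : Cell Γ Λ :=
  some (p.1.Tape.nth (i - p.2), if i = p.2 then some p.1.q else none)

/-- The state in which the head leaves a cell in the direction `d`. -/
def leaves {Γ Λ : Type} [Inhabited Λ] (M : Machine Γ Λ) (d : Dir) : Cell Γ Λ → Option Λ
  | some (a, some q) =>
    match M q a, d with
    | some (q', .move .left), .left => some q'
    | some (q', .move .right), .right => some q'
    | _, _ => none
  | _ => none

/-- The cell in the next row, given a cell and its two neighbours. -/
def nextCell {Γ Λ : Type} [Inhabited Λ] (M : Machine Γ Λ) (l c r : Cell Γ Λ) : Cell Γ Λ :=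
  match c with
  | none => none
  | some (a, some q) =>
    match M q a with
    | none => some (a, some q)
    | some (_, .move _) => some (a, none)
    | some (q', .write b) => some (b, some q')
  | some (a, none) => some (a, (leaves M .right l).or (leaves M .left r))

variable {M}

theorem leaves_cellAt_of_ne {p : PosCfg Γ Λ} {i : ℤ} (h : p.2 ≠ i) (d : Dir) :
    leaves M d (cellAt p i) = none := by
  simp [leaves, cellAt, Ne.symm h]

theorem leaves_cellAt_self (p : PosCfg Γ Λ) (d : Dir) :
    leaves M d (cellAt p p.2) = match M p.1.q p.1.Tape.head, d with
      | some (q', .move .left), .left => some q'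
      | some (q', .move .right), .right => some q'
      | _, _ => none := by
  simp [leaves, cellAt]

/-- Neighbours matter only through a head that they send over, which is why a separator can replace
a neighbour without head. -/
theorem nextCell_congr {Γ Λ : Type} [Inhabited Λ] {M : Machine Γ Λ} {l l' r r' : Cell Γ Λ}
    (c : Cell Γ Λ)
    (hl : leaves M .right l = leaves M .right l') (hr : leaves M .left r = leaves M .left r') :
    nextCell M l c r = nextCell M l' c r' := by
  simp only [nextCell, hl, hr]

/-- A step is local. The cases are: head on the cell, head on its left neighbour, head on its right
neighbour, head elsewhere. -/
theorem nextCell_cellAt (p : PosCfg Γ Λ) (i : ℤ) :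
    nextCell M (cellAt p (i - 1)) (cellAt p i) (cellAt p (i + 1)) = cellAt (posStep M p) i := by
  obtain ⟨⟨q, T⟩, h⟩ := p
  have hr : (T.move .right).head = T.nth 1 := by rw [← Tape.nth_zero, Tape.move_right_nth]; rfl
  have hl : (T.move .left).head = T.nth (-1) := by rw [← Tape.nth_zero, Tape.move_left_nth]; rfl
  by_cases h₀ : i = h
  · subst h₀
    have hc : cellAt ((⟨q, T⟩, i) : PosCfg Γ Λ) i = some (T.head, some q) := by simp [cellAt]
    simp only [nextCell, hc, posStep]
    rcases M q T.head with _ | ⟨q', (_ | _) | a⟩ <;>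
      simp [cellAt, Tape.move_left_nth, Tape.move_right_nth, Tape.write]
    omega
  have hc : cellAt (⟨q, T⟩, h) i = some (T.nth (i - h), none) := by simp [cellAt, h₀]
  rw [hc]
  by_cases h₁ : i = h + 1
  · have : i - 1 = h := by omega
    rw [this]
    have h₂ : leaves M .left (cellAt ((⟨q, T⟩, h) : PosCfg Γ Λ) (i + 1)) = none :=
      leaves_cellAt_of_ne (by dsimp only; omega) _
    have h₃ := leaves_cellAt_self (M := M) ((⟨q, T⟩, h) : PosCfg Γ Λ) .right
    dsimp only at h₃
    simp only [nextCell, h₂, h₃, posStep]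
    rcases M q T.head with _ | ⟨q', (_ | _) | a⟩ <;>
      simp [cellAt, Tape.move_left_nth, h₁, Tape.write_nth, hr]
    omega
  by_cases h₂ : i = h - 1
  · have : i + 1 = h := by omega
    rw [this]
    have h₄ : leaves M .right (cellAt ((⟨q, T⟩, h) : PosCfg Γ Λ) (i - 1)) = none :=
      leaves_cellAt_of_ne (by dsimp only; omega) _
    have h₃ := leaves_cellAt_self (M := M) ((⟨q, T⟩, h) : PosCfg Γ Λ) .left
    dsimp only at h₃
    simp only [nextCell, h₄, h₃, posStep]
    rcases M q T.head with _ | ⟨q', (_ | _) | a⟩ <;>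
      simp [cellAt, Tape.move_right_nth, h₂, Tape.write_nth, hl]
    exact ⟨congrArg _ (by ring), by omega⟩
  have h₃ : leaves M .left (cellAt ((⟨q, T⟩, h) : PosCfg Γ Λ) (i + 1)) = none :=
    leaves_cellAt_of_ne (by dsimp only; omega) _
  have h₄ : leaves M .right (cellAt ((⟨q, T⟩, h) : PosCfg Γ Λ) (i - 1)) = none :=
    leaves_cellAt_of_ne (by dsimp only; omega) _
  simp only [nextCell, h₃, h₄, posStep]
  have e₁ : i - (h + 1) + 1 = i - h := by ring
  have e₂ : i - (h - 1) - 1 = i - h := by ring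
  have e₃ : ¬ i - h = 0 := by omega
  rcases M q T.head with _ | ⟨q', (_ | _) | a⟩ <;>
    simp [cellAt, Tape.move_left_nth, Tape.move_right_nth, h₀, h₁, h₂, Tape.write_nth, e₁, e₂, e₃]

end Turing.TM0

/-! ### The conditions on the words that describe halting computations -/

/-- The phases of reading the first row, apart from the phase that counts input symbols. -/
inductive Phase : Type
  | first
  | left
  | right

namespace Turing.TM0

variable {Γ Λ : Type} [Inhabited Γ] [Inhabited Λ]

/-- A letter of the word: a cell with its two neighbours. -/
abbrev Letter (Γ Λ : Type) : Type := Cell Γ Λ × Cell Γ Λ × Cell Γ Λ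

/-- The cell that a letter stands for. -/
abbrev Letter.cell (x : Letter Γ Λ) : Cell Γ Λ := x.2.1

/-- The letter does not describe a head that moves onto a separator. -/
def Letter.Inside (M : Machine Γ Λ) (x : Letter Γ Λ) : Prop :=
  x.cell = none → leaves M .right x.1 = none ∧ leaves M .left x.2.2 = none

/-- The machine has halted with the head at this cell. -/
def Cell.Halted (M : Machine Γ Λ) : Cell Γ Λ → Prop
  | some (a, some q) => M q a = none
  | _ => False

variable {B : Type} (e : B ≃ Letter Γ Λ) (M : Machine Γ Λ) (X Y : Γ)

open Classical in
/-- The first row consists of a separator, blanks, the input `X Y … Y` of length `n + 2` with the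
head on its first symbol, and at least one more blank. -/
noncomputable def firstRow (n : ℕ) : Phase ⊕ Fin (n + 1) → B → Option (Option (Phase ⊕ Fin (n + 1)))
  | .inl .first, b => if (e b).cell = none then some (some (.inl .left)) else none
  | .inl .left, b =>
    if (e b).cell = some (X, some default) then some (some (.inr 0))
    else if (e b).cell = some (default, none) then some (some (.inl .left)) else none
  | .inr i, b =>
    if (e b).cell = some (Y, none) then
      if h : i < n then some (some (.inr ⟨i + 1, by omega⟩)) else some (some (.inl .right))
    else none
  | .inl .right, b =>
    if (e b).cell = some (default, none) then
      if (e b).2.2 = none then some none else some (some (.inl .right))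
    else none

open Classical in
/-- The conditions for halting computations with input `X Y … Y` of length `n + 2`. -/
noncomputable def checker (n : ℕ) : Checker B (Phase ⊕ Fin (n + 1)) where
  hor p b := decide ((e b).Inside M ∧
    ∀ a ∈ p, (e a).cell = (e b).1 ∧ (e a).2.2 = (e b).cell)
  ver a b := decide ((e b).cell = nextCell M (e a).1 (e a).cell (e a).2.2)
  goal b := decide ((e b).cell.Halted M)
  wait₀ := .inl .first
  wait := firstRow e X Y n

variable {e M X Y} {n : ℕ}

local notation "𝓢" => checker e M X Y n

/-- The last cell `k` of the first row is recognized one letter ahead of the separator, by the right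
neighbour in its window; the comparison therefore starts exactly with the second row. -/
theorem waitRun_right (w : List B) (t : ℕ → B) (i m : ℕ) :
    (𝓢).WaitRun w (.inl .right) (letters t i m) ↔
      ∃ k, i ≤ k ∧ k < i + m ∧ (∀ j, i ≤ j → j ≤ k → (e (t j)).cell = some (default, none)) ∧
        (∀ j, i ≤ j → j < k → (e (t j)).2.2 ≠ none) ∧ (e (t k)).2.2 = none ∧
        (𝓢).CheckRun false w (letters t (k + 1) (i + m - (k + 1))) := by
  induction m generalizing i with
  | zero =>
    simp only [letters, List.range'_zero, List.map_nil, Checker.WaitRun, false_iff]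
    rintro ⟨k, h₁, h₂, -⟩
    omega
  | succ m ih =>
    rw [letters_succ, Checker.WaitRun]
    by_cases hb : (e (t i)).cell = some (default, none)
    · by_cases hr : (e (t i)).2.2 = none
      · simp only [checker, firstRow, hb, hr, if_true]
        constructor
        · intro h
          refine ⟨i, le_rfl, by omega, fun j h₁ h₂ => ?_, fun j h₁ h₂ => by omega, hr, ?_⟩
          · rwa [le_antisymm h₂ h₁]
          · convert h using 2
            omega
        · rintro ⟨k, h₁, h₂, h₃, h₄, h₅, h₆⟩
          rcases h₁.eq_or_lt with rfl | h₁
          · convert h₆ using 2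
            omega
          · exact (h₄ i le_rfl h₁ hr).elim
      · simp only [checker, firstRow, hb, hr, if_true, if_false]
        refine (ih (i + 1)).trans ?_
        constructor
        · rintro ⟨k, h₁, h₂, h₃, h₄, h₅, h₆⟩
          refine ⟨k, by omega, by omega, fun j h₁' h₂' => ?_, fun j h₁' h₂' => ?_, h₅, ?_⟩
          · rcases h₁'.eq_or_lt with rfl | h₁'
            · exact hb
            · exact h₃ j h₁' h₂'
          · rcases h₁'.eq_or_lt with rfl | h₁'
            · exact hr
            · exact h₄ j h₁' h₂'
          · rwa [show i + (m + 1) - (k + 1) = i + 1 + m - (k + 1) by omega]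
        · rintro ⟨k, h₁, h₂, h₃, h₄, h₅, h₆⟩
          rcases h₁.eq_or_lt with rfl | h₁
          · exact (hr h₅).elim
          · refine ⟨k, h₁, by omega, fun j h₁' h₂' => h₃ j (by omega) h₂',
              fun j h₁' h₂' => h₄ j (by omega) h₂', h₅, ?_⟩
            rwa [show i + 1 + m - (k + 1) = i + (m + 1) - (k + 1) by omega]
    · simp only [checker, firstRow, hb, if_false, false_iff]
      rintro ⟨k, h₁, h₂, h₃, -⟩
      exact hb (h₃ i le_rfl h₁)

/-- With `c` symbols `Y` already counted, the present one and `d` more are due. -/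
theorem waitRun_count (w : List B) (t : ℕ → B) (i m : ℕ) (c d : ℕ) (hcd : c + d = n) :
    (𝓢).WaitRun w (.inr ⟨c, by omega⟩) (letters t i m) ↔
      d < m ∧ (∀ j, i ≤ j → j ≤ i + d → (e (t j)).cell = some (Y, none)) ∧
        (𝓢).WaitRun w (.inl .right) (letters t (i + d + 1) (m - (d + 1))) := by
  cases m with
  | zero =>
    simp [letters, Checker.WaitRun]
  | succ m =>
    rw [letters_succ, Checker.WaitRun]
    by_cases hb : (e (t i)).cell = some (Y, none)
    · induction d generalizing c i m with
      | zero =>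
        have : ¬ c < n := by omega
        simp only [checker, firstRow, hb, if_true, this, dif_neg, not_false_iff]
        constructor
        · intro h
          refine ⟨by omega, fun j h₁ h₂ => ?_, by simpa using h⟩
          rwa [le_antisymm h₂ h₁]
        · rintro ⟨-, -, h⟩
          simpa using h
      | succ d ih =>
        have : c < n := by omega
        simp only [checker, firstRow, hb, if_true, this, dif_pos]
        cases m with
        | zero => simp [letters, Checker.WaitRun]
        | succ m =>
          rw [letters_succ, Checker.WaitRun]
          by_cases hb' : (e (t (i + 1))).cell = some (Y, none)
          · refine (ih (i + 1) (c + 1) (by omega) m hb').trans ?_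
            rw [show i + 1 + d + 1 = i + (d + 1) + 1 by ring,
              show m + 1 - (d + 1) = m + 1 + 1 - (d + 1 + 1) by omega]
            refine and_congr (by omega) (and_congr ?_ Iff.rfl)
            constructor
            · intro h j h₁ h₂
              rcases h₁.eq_or_lt with rfl | h₁
              · exact hb
              · exact h j h₁ (by omega)
            · exact fun h j h₁ h₂ => h j (by omega) (by omega)
          · simp only [firstRow, hb', if_false, false_iff]
            rintro ⟨-, h, -⟩
            exact hb' (h _ (by omega) (by omega))
    · simp only [checker, firstRow, hb, if_false, false_iff]
      rintro ⟨-, h, -⟩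
      exact hb (h _ (by omega) (by omega))

theorem waitRun_left (w : List B) (t : ℕ → B) (i m : ℕ) :
    (𝓢).WaitRun w (.inl .left) (letters t i m) ↔
      ∃ h, i ≤ h ∧ h < i + m ∧ (∀ j, i ≤ j → j < h → (e (t j)).cell = some (default, none)) ∧
        (e (t h)).cell = some (X, some default) ∧
        (𝓢).WaitRun w (.inr 0) (letters t (h + 1) (i + m - (h + 1))) := by
  induction m generalizing i with
  | zero =>
    simp only [letters, List.range'_zero, List.map_nil, Checker.WaitRun, false_iff]
    rintro ⟨k, h₁, h₂, -⟩
    omega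
  | succ m ih =>
    rw [letters_succ, Checker.WaitRun]
    by_cases hx : (e (t i)).cell = some (X, some default)
    · simp only [checker, firstRow, hx, if_true]
      constructor
      · intro h
        refine ⟨i, le_rfl, by omega, fun j h₁ h₂ => by omega, hx, ?_⟩
        convert h using 2
        omega
      · rintro ⟨k, h₁, h₂, h₃, h₄, h₅⟩
        rcases h₁.eq_or_lt with rfl | h₁
        · convert h₅ using 2
          omega
        · have := h₃ i le_rfl h₁
          rw [hx] at this
          simp at this
    · by_cases hb : (e (t i)).cell = some (default, none)
      · have hne : ¬ (some (default, none) : Cell Γ Λ) = some (X, some default) := by simp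
        simp only [checker, firstRow, hb, if_true, hne, if_false]
        refine (ih (i + 1)).trans ?_
        constructor
        · rintro ⟨k, h₁, h₂, h₃, h₄, h₅⟩
          refine ⟨k, by omega, by omega, fun j h₁' h₂' => ?_, h₄, ?_⟩
          · rcases h₁'.eq_or_lt with rfl | h₁'
            · exact hb
            · exact h₃ j h₁' h₂'
          · rwa [show i + (m + 1) - (k + 1) = i + 1 + m - (k + 1) by omega]
        · rintro ⟨k, h₁, h₂, h₃, h₄, h₅⟩
          rcases h₁.eq_or_lt with rfl | h₁
          · exact (hx h₄).elim
          · refine ⟨k, h₁, by omega, fun j h₁' h₂' => h₃ j (by omega) h₂', h₄, ?_⟩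
            rwa [show i + 1 + m - (k + 1) = i + (m + 1) - (k + 1) by omega]
      · simp only [checker, firstRow, hb, hx, if_false, false_iff]
        rintro ⟨k, h₁, h₂, h₃, h₄, h₅⟩
        rcases h₁.eq_or_lt with rfl | h₁
        · exact hx h₄
        · exact hb (h₃ i le_rfl h₁)

/-- The conditions on the word `t 0, …, t (N - 1)` in terms of indices: `h` is the position of the
head in the first row, and `k` is the length of the rows. -/
theorem accepts_letters (t : ℕ → B) (N : ℕ) :
    (𝓢).Accepts (letters t 0 N) ↔
      (∀ j < N, (e (t j)).Inside M) ∧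
      (∀ j, j + 1 < N → (e (t j)).cell = (e (t (j + 1))).1 ∧
        (e (t j)).2.2 = (e (t (j + 1))).cell) ∧
      ∃ h k, 0 < h ∧ h + n + 2 < k ∧ k ≤ N ∧ (e (t 0)).cell = none ∧
        (∀ j, 0 < j → j < h → (e (t j)).cell = some (default, none)) ∧
        (e (t h)).cell = some (X, some default) ∧
        (∀ j, h < j → j ≤ h + n + 1 → (e (t j)).cell = some (Y, none)) ∧
        (∀ j, h + n + 1 < j → j < k → (e (t j)).cell = some (default, none)) ∧
        (∀ j, h + n + 1 < j → j + 1 < k → (e (t j)).2.2 ≠ none) ∧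
        (e (t (k - 1))).2.2 = none ∧
        (∀ j, k + j < N → (e (t (k + j))).cell =
          nextCell M (e (t j)).1 (e (t j)).cell (e (t j)).2.2) ∧
        ∃ j, k + j < N ∧ (e (t (k + j))).cell.Halted M := by
  classical
  have hcheck : ∀ k, k ≤ N → ((𝓢).CheckRun false (letters t 0 N) (letters t k (N - k)) ↔
      (∀ j, k + j < N → (e (t (k + j))).cell =
          nextCell M (e (t j)).1 (e (t j)).cell (e (t j)).2.2) ∧
        ∃ j, k + j < N ∧ (e (t (k + j))).cell.Halted M) := by
    intro k hk
    have := (𝓢).checkRun_letters t false 0 N k (N - k) (by omega)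
    rw [add_zero] at this
    rw [this]
    simp only [zero_le, true_implies, zero_add, Bool.false_eq_true, false_or, checker,
      decide_eq_true_eq, true_and, Nat.lt_sub_iff_add_lt']
  have hhor : (𝓢).EqRun none (letters t 0 N) ↔ (∀ j < N, (e (t j)).Inside M) ∧
      ∀ j, j + 1 < N → (e (t j)).cell = (e (t (j + 1))).1 ∧
        (e (t j)).2.2 = (e (t (j + 1))).cell := by
    rw [Checker.eqRun_letters]
    simp only [zero_le, true_implies, zero_add, checker, decide_eq_true_eq, Option.mem_def,
      reduceCtorEq, false_implies, implies_true, and_true, Option.some.injEq, forall_eq']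
    constructor
    · rintro ⟨h₀, h₁⟩
      refine ⟨fun j hj => ?_, fun j hj => (h₁ j hj).2⟩
      cases j with
      | zero => exact h₀ hj
      | succ j => exact (h₁ j hj).1
    · rintro ⟨h₀, h₁⟩
      exact ⟨h₀ 0, fun j hj => ⟨h₀ _ hj, h₁ j hj⟩⟩
  rw [Checker.Accepts, hhor, and_assoc]
  refine and_congr Iff.rfl (and_congr Iff.rfl ?_)
  cases N with
  | zero =>
    refine iff_of_false (fun h => h) ?_
    rintro ⟨h, k, h₁, h₂, h₃, -⟩
    omega
  | succ N =>
    have hfirst : ∀ w, (𝓢).WaitRun w (𝓢).wait₀ (letters t 0 (N + 1)) ↔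
        (e (t 0)).cell = none ∧ (𝓢).WaitRun w (.inl .left) (letters t 1 N) := by
      intro w
      rw [letters_succ, Checker.WaitRun]
      by_cases hb : (e (t 0)).cell = none
      · simp only [checker, firstRow, hb, if_true, true_and]
      · simp [checker, firstRow, hb]
    rw [hfirst, waitRun_left]
    have hcount := fun i m => waitRun_count (e := e) (M := M) (X := X) (Y := Y) (n := n)
      (letters t 0 (N + 1)) t i m 0 n (zero_add n)
    constructor
    · rintro ⟨h₀, h, h₁, h₂, h₃, h₄, h₅⟩
      obtain ⟨h₆, h₇, h₈⟩ := (hcount _ _).1 h₅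
      obtain ⟨k, h₉, h₁₀, h₁₁, h₁₂, h₁₃, h₁₄⟩ := (waitRun_right _ _ _ _).1 h₈
      rw [show h + 1 + n + 1 + (1 + N - (h + 1) - (n + 1)) - (k + 1) = N + 1 - (k + 1) by omega,
        hcheck (k + 1) (by omega)] at h₁₄
      -- Here `k` is the index of the last cell of the first row, so the row length is `k + 1`.
      exact ⟨h, k + 1, h₁, by omega, by omega, h₀, h₃, h₄,
        fun j hj hj' => h₇ j hj (by omega), fun j hj hj' => h₁₁ j (by omega) (by omega),
        fun j hj hj' => h₁₂ j (by omega) (by omega), h₁₃, h₁₄⟩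
    · rintro ⟨h, k, h₁, h₂, h₃, h₄, h₅, h₆, h₇, h₈, h₉, h₁₀, h₁₁⟩
      refine ⟨h₄, h, h₁, by omega, h₅, h₆, (hcount _ _).2 ⟨by omega,
        fun j hj hj' => h₇ j hj (by omega), (waitRun_right _ _ _ _).2 ⟨k - 1, by omega, by omega,
          fun j hj hj' => h₈ j (by omega) (by omega), fun j hj hj' => h₉ j (by omega) (by omega),
          h₁₀, ?_⟩⟩⟩
      rw [show h + 1 + n + 1 + (1 + N - (h + 1) - (n + 1)) - (k - 1 + 1) = N + 1 - k by omega,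
        show k - 1 + 1 = k by omega]
      exact (hcheck k h₃).2 h₁₁

end Turing.TM0

/-! ### Accepted words and halting computations -/

namespace Turing.TM0

variable {Γ Λ : Type} [Inhabited Γ] [Inhabited Λ]

/-- The initial configuration on the input `X Y … Y` of length `n + 2`, placed at `h`. -/
def initAt (X Y : Γ) (n : ℕ) (h : ℤ) : PosCfg Γ Λ := (init (X :: List.replicate (n + 1) Y), h)

theorem cellAt_initAt_self (X Y : Γ) (n : ℕ) (h : ℤ) :
    cellAt (initAt X Y n h : PosCfg Γ Λ) h = some (X, some default) := by
  simp only [cellAt, initAt, init, sub_self, if_true]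
  rfl

theorem cellAt_initAt_of_lt (X Y : Γ) (n : ℕ) {h i : ℤ} (hi : i < h) :
    cellAt (initAt X Y n h : PosCfg Γ Λ) i = some (default, none) := by
  obtain ⟨m, hm⟩ : ∃ m : ℕ, i - h = Int.negSucc m := Int.eq_negSucc_of_lt_zero (by omega)
  simp only [cellAt, initAt, init, hm, hi.ne, if_false]
  rfl

theorem cellAt_initAt_add (X Y : Γ) (n : ℕ) {h i : ℤ} (m : ℕ) (hi : i = h + (m + 1)) :
    cellAt (initAt X Y n h : PosCfg Γ Λ) i = some ((List.replicate (n + 1) Y).getI m, none) := by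
  have h₁ : i - h = ((m + 1 : ℕ) : ℤ) := by push_cast; omega
  have h₂ : i ≠ h := by omega
  simp only [cellAt, initAt, init, h₁, h₂, if_false, Tape.mk₁, Tape.mk₂, Tape.mk'_nth_nat,
    ListBlank.nth_mk, List.getI_cons_succ]

theorem cellAt_initAt_input (X Y : Γ) (n : ℕ) {h i : ℤ} (h₁ : h < i) (h₂ : i ≤ h + n + 1) :
    cellAt (initAt X Y n h : PosCfg Γ Λ) i = some (Y, none) := by
  obtain ⟨m, hm⟩ : ∃ m : ℕ, i = h + (m + 1) := ⟨(i - h - 1).toNat, by omega⟩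
  rw [cellAt_initAt_add X Y n m hm, List.getI_eq_getElem _ (by simp; omega)]
  simp

theorem cellAt_initAt_of_gt (X Y : Γ) (n : ℕ) {h i : ℤ} (h₁ : h + n + 1 < i) :
    cellAt (initAt X Y n h : PosCfg Γ Λ) i = some (default, none) := by
  obtain ⟨m, hm⟩ : ∃ m : ℕ, i = h + (m + 1) := ⟨(i - h - 1).toNat, by omega⟩
  rw [cellAt_initAt_add X Y n m hm, List.getI_eq_default _ (by simp; omega)]

variable {B : Type} {e : B ≃ Letter Γ Λ} {M : Machine Γ Λ} {X Y : Γ} {n : ℕ}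

local notation "𝓢" => checker e M X Y n

/-- Expresses head movements through `leaves`, the terms in which letters forbid a head to move onto
a separator. -/
theorem posStep_snd_eq_add_one_or {p : PosCfg Γ Λ} :
    (posStep M p).2 = p.2 ∨
      ((posStep M p).2 = p.2 + 1 ∧ leaves M .right (cellAt p p.2) ≠ none) ∨
      ((posStep M p).2 = p.2 - 1 ∧ leaves M .left (cellAt p p.2) ≠ none) := by
  rw [leaves_cellAt_self, leaves_cellAt_self]
  obtain ⟨⟨q, T⟩, h⟩ := p
  simp only [posStep]
  rcases M q T.head with _ | ⟨q', (_ | _) | a⟩ <;> simp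

theorem halted_cellAt_iff {p : PosCfg Γ Λ} {i : ℤ} :
    (cellAt p i).Halted M ↔ i = p.2 ∧ M p.1.q p.1.Tape.head = none := by
  by_cases h : i = p.2 <;> simp [cellAt, Cell.Halted, h]

theorem nextCell_cellAt_of {p : PosCfg Γ Λ} {i : ℤ} {l r : Cell Γ Λ}
    (hl : l = cellAt p (i - 1) ∨ l = none ∧ p.2 ≠ i - 1)
    (hr : r = cellAt p (i + 1) ∨ r = none ∧ p.2 ≠ i + 1) :
    nextCell M l (cellAt p i) r = cellAt (posStep M p) i := by
  rw [← nextCell_cellAt]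
  refine nextCell_congr _ ?_ ?_
  · rcases hl with rfl | ⟨rfl, h⟩
    · rfl
    · rw [leaves_cellAt_of_ne h]; rfl
  · rcases hr with rfl | ⟨rfl, h⟩
    · rfl
    · rw [leaves_cellAt_of_ne h]; rfl

/-- The rows of an accepted word are the successive configurations. -/
theorem dom_of_accepts_letters {t : ℕ → B} {N : ℕ} (hw : (𝓢).Accepts (letters t 0 N)) :
    (StateTransition.eval (step M) (init (X :: List.replicate (n + 1) Y))).Dom := by
  rw [accepts_letters] at hw
  obtain ⟨hin, hhor, h, k, h₁, h₂, h₃, h₄, h₅, h₆, h₇, h₈, -, h₉, hver, j, hj, hj'⟩ := hw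
  set p : ℕ → PosCfg Γ Λ := fun r => (posStep M)^[r] (initAt X Y n h) with hp
  have hps : ∀ r, p (r + 1) = posStep M (p r) := fun r => Function.iterate_succ_apply' _ _ _
  -- The invariant confines the head strictly between the separators. The last row may be cut off by
  -- the end of the word, hence the bounds by `N`.
  have key : ∀ r, r * k < N → (0 < (p r).2 ∧ (p r).2 < k) ∧ (e (t (r * k))).cell = none ∧
      ∀ i, 0 < i → i < k → r * k + i < N → (e (t (r * k + i))).cell = cellAt (p r) i := by
    intro r
    induction r with
    | zero =>
      intro _
      simp only [zero_mul, zero_add]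
      refine ⟨⟨by simp [hp, initAt, h₁], by simp [hp, initAt]; omega⟩, h₄, fun i hi hi' _ => ?_⟩
      simp only [hp, Function.iterate_zero, id]
      rcases lt_trichotomy i h with hlt | rfl | hgt
      · rw [h₅ i hi hlt, cellAt_initAt_of_lt X Y n (by omega)]
      · rw [h₆, cellAt_initAt_self]
      · by_cases hle : i ≤ h + n + 1
        · rw [h₇ i hgt hle, cellAt_initAt_input X Y n (by omega) (by omega)]
        · rw [h₈ i (by omega) hi', cellAt_initAt_of_gt X Y n (by omega)]
    | succ r ih =>
      intro hN
      have hN' : r * k + k < N := by rwa [Nat.succ_mul] at hN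
      obtain ⟨⟨a₁, a₂⟩, a₃, a₄⟩ := ih (by omega)
      have hsep : (e (t (r * k + k))).cell = none := by
        rw [add_comm (r * k), hver _ (by omega), a₃]
        rfl
      rw [Nat.succ_mul, hps]
      refine ⟨?_, hsep, fun i hi hi' hiN => ?_⟩
      · rcases posStep_snd_eq_add_one_or (M := M) (p := p r) with h | ⟨h, hl⟩ | ⟨h, hl⟩
        · rw [h]; exact ⟨a₁, a₂⟩
        -- A head leaving cell `k - 1` to the right would enter the next separator, whose letter
        -- excludes this; cell `1` and the preceding separator are treated alike below.
        · refine ⟨by omega, lt_of_le_of_ne (by omega) fun hk => hl ?_⟩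
          have := (hin _ hN' hsep).1
          rwa [show r * k + k = r * k + (k - 1) + 1 by omega, ← (hhor _ (by omega)).1,
            a₄ (k - 1) (by omega) (by omega) (by omega),
            show ((k - 1 : ℕ) : ℤ) = (p r).2 by omega] at this
        · refine ⟨lt_of_le_of_ne (by omega) fun hk => hl ?_, by omega⟩
          have := (hin (r * k) (by omega) a₃).2
          rwa [(hhor _ (by omega)).2, a₄ 1 (by omega) (by omega) (by omega),
            show ((1 : ℕ) : ℤ) = (p r).2 by omega] at this
      · rw [show r * k + k + i = k + (r * k + i) by ring, hver _ (by omega),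
          a₄ i hi hi' (by omega)]
        refine nextCell_cellAt_of ?_ ?_
        · rw [show r * k + i = r * k + (i - 1) + 1 by omega, ← (hhor _ (by omega)).1]
          by_cases hi1 : i = 1
          · subst hi1
            exact .inr ⟨a₃, by omega⟩
          · left
            rw [a₄ (i - 1) (by omega) (by omega) (by omega)]
            congr 1
            omega
        · rw [(hhor _ (by omega)).2]
          by_cases hi1 : i + 1 = k
          · rw [add_assoc, hi1]
            exact .inr ⟨hsep, by omega⟩
          · left
            rw [add_assoc, a₄ (i + 1) (by omega) (by omega) (by omega)]
            rfl
  rw [show init (X :: List.replicate (n + 1) Y) = (initAt X Y n h : PosCfg Γ Λ).1 from rfl,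
    eval_dom_iff]
  -- The halted cell at index `k + j` lies in row `(k + j) / k`; it is not a separator, so it shows
  -- the head of that configuration.
  have hdiv := Nat.div_add_mod' (k + j) k
  have hmod := Nat.mod_lt (k + j) (show k > 0 by omega)
  obtain ⟨-, b₁, b₂⟩ := key ((k + j) / k) (by omega)
  refine ⟨(k + j) / k, ?_⟩
  rw [step_eq_none_iff]
  rw [← hdiv] at hj'
  rcases Nat.eq_zero_or_pos ((k + j) % k) with h0 | h0
  · rw [h0, add_zero, b₁] at hj'
    exact hj'.elim
  · rw [b₂ _ h0 hmod (by omega)] at hj'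
    exact (halted_cellAt_iff.1 hj').2

/-- The position is mere bookkeeping, so the input may be placed anywhere in the row. -/
theorem iterate_posStep_fst (c : Cfg Γ Λ) (h h' : ℤ) (r : ℕ) :
    ((posStep M)^[r] (c, h)).1 = ((posStep M)^[r] (c, h')).1 := by
  induction r with
  | zero => rfl
  | succ r ih =>
    rw [Function.iterate_succ_apply', Function.iterate_succ_apply', posStep_fst, posStep_fst, ih]

/-- A halting computation is described by an accepted word. -/
theorem exists_accepts_of_dom
    (hdom : (StateTransition.eval (step M) (init (X :: List.replicate (n + 1) Y))).Dom) :
    ∃ w : List B, (𝓢).Accepts w := by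
  rw [show init (X :: List.replicate (n + 1) Y) = (initAt X Y n 0 : PosCfg Γ Λ).1 from rfl,
    eval_dom_iff] at hdom
  obtain ⟨R, hR⟩ := hdom
  -- The margins on both sides of the input exceed the number of steps, so that the head never comes
  -- next to a separator.
  obtain ⟨h, hh⟩ : ∃ h : ℕ, h = R + 4 := ⟨_, rfl⟩
  obtain ⟨k, hk⟩ : ∃ k : ℕ, k = h + n + 1 + R + 4 := ⟨_, rfl⟩
  set p : ℕ → PosCfg Γ Λ := fun r => (posStep M)^[r] (initAt X Y n h) with hp
  have hps : ∀ r, p (r + 1) = posStep M (p r) := fun r => Function.iterate_succ_apply' _ _ _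
  have hpos : ∀ r, r ≤ R + 2 → 2 ≤ (p r).2 ∧ (p r).2 + 2 ≤ k := by
    intro r hr
    have : |(p r).2 - h| ≤ r := abs_iterate_posStep_snd_le M (initAt X Y n h) r
    rw [abs_le] at this
    omega
  set z : ℕ → Cell Γ Λ := fun j => if j % k = 0 then none else cellAt (p (j / k)) (j % k : ℕ)
    with hz
  have hsep : ∀ r, z (r * k) = none := fun r => by simp [hz]
  have hcell : ∀ r i, 0 < i → i < k → z (r * k + i) = cellAt (p r) i := by
    intro r i hi hik
    have h₁ : (r * k + i) % k = i := by
      rw [mul_comm, Nat.mul_add_mod, Nat.mod_eq_of_lt hik]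
    have h₂ : (r * k + i) / k = r := by
      rw [mul_comm, Nat.mul_add_div (by omega), Nat.div_eq_of_lt hik, add_zero]
    simp only [hz, h₁, h₂, if_neg hi.ne']
  have hcell₀ : ∀ i, 0 < i → i < k → z i = cellAt (initAt X Y n h) i := by
    intro i hi hik
    simpa [hp] using hcell 0 i hi hik
  -- At `j = 0` the truncated subtraction makes the left neighbour `z 0`, a separator, which is
  -- harmless.
  refine ⟨letters (fun j => e.symm (z (j - 1), z j, z (j + 1))) 0 ((R + 2) * k), ?_⟩
  rw [accepts_letters]
  simp only [Equiv.apply_symm_apply, Letter.Inside, Letter.cell]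
  refine ⟨fun j hj hjz => ?_, fun j hj => by simp, h, k, by omega, by omega, by nlinarith,
    by simpa using hsep 0, fun j h₁ h₂ => ?_, ?_, fun j h₁ h₂ => ?_, fun j h₁ h₂ => ?_,
    fun j h₁ h₂ => ?_, ?_, fun j hj => ?_, ?_⟩
  · obtain ⟨r, i, hik, rfl⟩ : ∃ r i, i < k ∧ j = r * k + i :=
      ⟨j / k, j % k, Nat.mod_lt _ (by omega), (Nat.div_add_mod' j k).symm⟩
    rcases Nat.eq_zero_or_pos i with rfl | hi
    · have hr : r < R + 2 := lt_of_mul_lt_mul_right (by simpa using hj) (Nat.zero_le k)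
      constructor
      · cases r with
        | zero =>
          simp only [zero_mul, add_zero, Nat.zero_sub]
          rw [show z 0 = none by simpa using hsep 0]
          rfl
        | succ r =>
          rw [show (r + 1) * k + 0 - 1 = r * k + (k - 1) by rw [Nat.succ_mul]; omega,
            hcell _ _ (by omega) (by omega), leaves_cellAt_of_ne]
          have := hpos r (by omega)
          omega
      · rw [add_zero, hcell r 1 (by omega) (by omega), leaves_cellAt_of_ne]
        have := hpos r (by omega)
        omega
    · rw [hcell r i hi hik] at hjz
      simp [cellAt] at hjz
  · rw [hcell₀ j h₁ (by omega), cellAt_initAt_of_lt X Y n (by omega)]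
  · rw [hcell₀ h (by omega) (by omega), cellAt_initAt_self]
  · rw [hcell₀ j (by omega) (by omega), cellAt_initAt_input X Y n (by omega) (by omega)]
  · rw [hcell₀ j (by omega) (by omega), cellAt_initAt_of_gt X Y n (by omega)]
  · rw [hcell₀ (j + 1) (by omega) (by omega)]
    simp [cellAt]
  · rw [show k - 1 + 1 = 1 * k by omega, hsep]
  · obtain ⟨r, i, hik, rfl⟩ : ∃ r i, i < k ∧ j = r * k + i :=
      ⟨j / k, j % k, Nat.mod_lt _ (by omega), (Nat.div_add_mod' j k).symm⟩
    have hr : r < R + 1 := by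
      refine lt_of_mul_lt_mul_right (a := k) ?_ (Nat.zero_le k)
      rw [show (R + 2) * k = (R + 1) * k + k by ring] at hj
      omega
    rw [show k + (r * k + i) = (r + 1) * k + i by ring]
    rcases Nat.eq_zero_or_pos i with rfl | hi
    · rw [add_zero, add_zero, hsep, hsep]
      rfl
    · have := hpos r (by omega)
      rw [hcell _ _ hi hik, hcell _ _ hi hik, hps]
      refine (nextCell_cellAt_of ?_ ?_).symm
      · rcases Nat.lt_or_ge 1 i with hi1 | hi1
        · left
          rw [show r * k + i - 1 = r * k + (i - 1) by omega, hcell _ _ (by omega) (by omega)]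
          congr 1
          omega
        · right
          rw [show r * k + i - 1 = r * k by omega]
          exact ⟨hsep r, by omega⟩
      · rcases Nat.lt_or_ge (i + 1) k with hi1 | hi1
        · left
          rw [add_assoc, hcell _ _ (by omega) (by omega)]
          rfl
        · right
          rw [show r * k + i + 1 = (r + 1) * k by rw [Nat.succ_mul]; omega]
          exact ⟨hsep _, by omega⟩
  -- Row `R + 1` repeats the halted row `R`. The repetition matters when `R = 0`, because the goal
  -- has to be met behind the first row.
  · have hpR : M (p R).1.q (p R).1.Tape.head = none := by
      rw [← step_eq_none_iff, ← hR]
      exact congrArg _ (iterate_posStep_fst _ _ _ _)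
    have hpR' : p (R + 1) = p R := by
      rw [hps, posStep, hpR]
    have := hpos R (by omega)
    refine ⟨R * k + (p R).2.toNat, ?_, ?_⟩
    · rw [show (R + 2) * k = k + R * k + k by ring]
      omega
    · rw [show k + (R * k + (p R).2.toNat) = (R + 1) * k + (p R).2.toNat by ring,
        hcell _ _ (by omega) (by omega), hpR', Int.toNat_of_nonneg (by omega)]
      exact halted_cellAt_iff.2 ⟨rfl, hpR⟩

theorem exists_accepts_iff : (∃ w : List B, (𝓢).Accepts w) ↔
    (StateTransition.eval (step M) (init (X :: List.replicate (n + 1) Y))).Dom := by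
  refine ⟨fun ⟨w, hw⟩ => ?_, exists_accepts_of_dom⟩
  rw [← letters_getD w (e.symm (none, none, none))] at hw
  exact dom_of_accepts_letters hw

end Turing.TM0

/-! ### The descriptions are computable -/

theorem List.ofFn_eq_map_range {α : Type} {n : ℕ} (f : Fin n → α) (g : ℕ → α)
    (h : ∀ i, f i = g i) : List.ofFn f = (List.range n).map g := by
  refine List.ext_getElem (by simp) fun i h₁ h₂ => ?_
  simp [h]

/-- A table with a constant initial part of length `K` and a uniformly computable rest; the private
states are numbered so that their tables have this shape. -/
theorem Primrec.ofFn_add {α : Type} [Primcodable α] {K : ℕ} {f : ∀ n : ℕ, Fin (K + (n + 1)) → α}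
    (base : Fin K → α) (g : ℕ → ℕ → α) (hg : Primrec₂ g)
    (hbase : ∀ n i, f n (Fin.castAdd (n + 1) i) = base i)
    (hstep : ∀ n i, f n (Fin.natAdd K i) = g n i) : Primrec fun n => List.ofFn (f n) := by
  have h : ∀ n, List.ofFn base ++ (List.range (n + 1)).map (g n) = List.ofFn (f n) := by
    intro n
    rw [List.ofFn_add]
    congr 1
    · congr 1
      funext i
      exact (hbase n i).symm
    · exact (List.ofFn_eq_map_range _ _ (hstep n)).symm
  exact (Primrec.list_append.comp (Primrec.const _)
    (Primrec.list_map (Primrec.list_range.comp Primrec.succ) hg)).of_eq h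

instance Ctrl.instFinite {B : Type} [Finite B] : Finite (Ctrl B) := by
  refine Finite.of_surjective (fun x : Bool ⊕ Option B ⊕ Bool => match x with
    | .inl true => Ctrl.start
    | .inl false => Ctrl.dead
    | .inr (.inl p) => Ctrl.eq p
    | .inr (.inr f) => Ctrl.check f) ?_
  rintro (_ | _ | p | f)
  exacts [⟨.inl true, rfl⟩, ⟨.inl false, rfl⟩, ⟨.inr (.inl p), rfl⟩, ⟨.inr (.inr f), rfl⟩]

instance Phase.instFinite : Finite Phase := by
  refine Finite.of_surjective (fun x : Option Bool => match x with
    | none => Phase.first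
    | some true => Phase.left
    | some false => Phase.right) ?_
  rintro (_ | _ | _)
  exacts [⟨none, rfl⟩, ⟨some true, rfl⟩, ⟨some false, rfl⟩]

namespace Turing.TM0

variable {Γ Λ : Type} [Inhabited Γ] [Inhabited Λ]

/-- The number of private states that do not depend on the length of the input. -/
noncomputable def numBase (b : ℕ) : ℕ := Nat.card (Ctrl (Fin b) ⊕ Phase)

/-- The numbering of the private states that do not depend on the length of the input. -/
noncomputable def baseEquiv (b : ℕ) : Ctrl (Fin b) ⊕ Phase ≃ Fin (numBase b) := Finite.equivFin _

/-- The numbering of the private states. -/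
noncomputable def modeEquiv (b n : ℕ) :
    Fin (numBase b + (n + 1)) ≃ Checker.Mode (Fin b) (Phase ⊕ Fin (n + 1)) :=
  finSumFinEquiv.symm.trans (((baseEquiv b).symm.sumCongr (Equiv.refl _)).trans
    (Equiv.sumAssoc _ _ _))

theorem modeEquiv_castAdd (b n : ℕ) (x : Ctrl (Fin b) ⊕ Phase) :
    modeEquiv b n (Fin.castAdd (n + 1) (baseEquiv b x)) = Equiv.sumAssoc _ _ _ (.inl x) := by
  simp [modeEquiv]

theorem modeEquiv_natAdd (b n : ℕ) (i : Fin (n + 1)) :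
    modeEquiv b n (Fin.natAdd (numBase b) i) = .inr (.inr i) := by
  simp [modeEquiv]

theorem modeEquiv_symm_inl (b n : ℕ) (x : Ctrl (Fin b)) :
    ((modeEquiv b n).symm (.inl x) : ℕ) = baseEquiv b (.inl x) := by
  simp [modeEquiv]

theorem modeEquiv_symm_phase (b n : ℕ) (x : Phase) :
    ((modeEquiv b n).symm (.inr (.inl x)) : ℕ) = baseEquiv b (.inr x) := by
  simp [modeEquiv]

theorem modeEquiv_symm_count (b n : ℕ) (i : Fin (n + 1)) :
    ((modeEquiv b n).symm (.inr (.inr i)) : ℕ) = numBase b + i := by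
  simp [modeEquiv]

variable {b : ℕ} [Nontrivial (Fin b)] (e : Fin b ≃ Letter Γ Λ) (M : Machine Γ Λ) (X Y : Γ)
  (g₀ : Fin b)

/-- The automaton that accepts descriptions of halting computations on the input `X Y … Y` of
length `n + 2`. -/
noncomputable def haltingPAFA (n : ℕ) :
    PAFA (Fin (b + 1)) (Fin (numBase b + (n + 1))) (Fin b) (Fin b) (Fin 2) :=
  (checker e M X Y n).pafa g₀ (finSuccEquiv b) (modeEquiv b n)

theorem haltingPAFA_deltaU_of_next (n : ℕ) (c : Fin (b + 1)) (p : Fin (numBase b + (n + 1)))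
    (a : Option (Fin b)) (h : (finSuccEquiv b c, modeEquiv b n p) ≠ (none, .inl .start)) :
    PAFA.describeU ((haltingPAFA e M X Y g₀ n).deltaU c p a) =
      [((((finSuccEquiv b).symm
          ((checker e M X Y n).next g₀ (finSuccEquiv b c) (modeEquiv b n p) a).1 : Fin (b + 1)) : ℕ),
        (((modeEquiv b n).symm
          ((checker e M X Y n).next g₀ (finSuccEquiv b c) (modeEquiv b n p) a).2 : Fin _) : ℕ))] := by
  simp only [haltingPAFA, Checker.pafa]
  generalize finSuccEquiv b c = c' at *
  generalize modeEquiv b n p = m at *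
  rcases c' with _ | c' <;> rcases m with (_ | _ | _ | _) | _ <;>
    first | exact (h rfl).elim | rfl

/-- The rows of the transition table that do not depend on the length of the input. -/
theorem describeU_deltaU_base (n : ℕ) (c : Fin (b + 1)) (x : Ctrl (Fin b) ⊕ Phase)
    (a : Option (Fin b)) :
    PAFA.describeU ((haltingPAFA e M X Y g₀ n).deltaU c
        (Fin.castAdd (n + 1) (baseEquiv b x)) a) =
      PAFA.describeU ((haltingPAFA e M X Y g₀ 0).deltaU c (Fin.castAdd 1 (baseEquiv b x)) a) := by
  by_cases h : finSuccEquiv b c = none ∧ x = .inl .start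
  · obtain ⟨hc, rfl⟩ := h
    have := modeEquiv_castAdd b n (.inl .start)
    have h' := modeEquiv_castAdd b 0 (.inl .start)
    simp only [haltingPAFA, Checker.pafa, this, h', hc, Equiv.sumAssoc_apply_inl_inl,
      Checker.move, LabelledMove.map, PAFA.describeU]
    congr 1
  · have hne : ∀ m, (finSuccEquiv b c, modeEquiv b m (Fin.castAdd (m + 1) (baseEquiv b x))) ≠
        (none, .inl .start) := by
      intro m hm
      rw [Prod.mk.injEq, modeEquiv_castAdd] at hm
      refine h ⟨hm.1, ?_⟩
      have := hm.2
      rcases x with x | x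
      · simpa using this
      · simp at this
    rw [haltingPAFA_deltaU_of_next _ _ _ _ _ _ _ _ _ (hne n),
      haltingPAFA_deltaU_of_next _ _ _ _ _ _ _ _ _ (hne 0), modeEquiv_castAdd, modeEquiv_castAdd]
    generalize finSuccEquiv b c = c'
    have hhor : (checker e M X Y n).hor = (checker e M X Y 0).hor := rfl
    have hver : (checker e M X Y n).ver = (checker e M X Y 0).ver := rfl
    have hgoal : (checker e M X Y n).goal = (checker e M X Y 0).goal := rfl
    have hwait : ∀ m, (checker e M X Y m).wait = firstRow e X Y m := fun _ => rfl
    clear hne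
    -- The only way from these states into the counter leads to its value 0, whose number `numBase
    -- b` does not depend on `n`.
    rcases c' with _ | c' <;> rcases x with (_ | _ | p | (_ | _)) | (_ | _ | _) <;>
      rcases a with _ | a <;>
      simp only [Equiv.sumAssoc_apply_inl_inl, Equiv.sumAssoc_apply_inl_inr, Checker.next, hhor, hver,
        hgoal, hwait, firstRow] <;>
      (try split_ifs) <;>
      simp [modeEquiv_symm_inl, modeEquiv_symm_phase, modeEquiv_symm_count]

open Classical in
/-- The rows of the transition table for the states that count the input. -/
noncomputable def countRow (c : Fin (b + 1)) (n i : ℕ) : List (List (ℕ × ℕ)) :=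
  match finSuccEquiv b c with
  | none =>
    let s : ℕ := ((finSuccEquiv b).symm (some g₀) : Fin (b + 1))
    [(s, numBase b + i)] :: List.ofFn fun _ : Fin b => [(s, numBase b + i)]
  | some _ =>
    let s : ℕ := ((finSuccEquiv b).symm none : Fin (b + 1))
    [(s, (baseEquiv b (.inl .dead) : ℕ))] :: List.ofFn fun a : Fin b =>
      if (e a).cell = some (Y, none) then
        if i < n then [(s, numBase b + i + 1)] else [(s, (baseEquiv b (.inr .right) : ℕ))]
      else [(s, (baseEquiv b (.inl .dead) : ℕ))]

theorem describeU_deltaU_count (n : ℕ) (c : Fin (b + 1)) (i : Fin (n + 1)) :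
    (PAFA.describeU ((haltingPAFA e M X Y g₀ n).deltaU c (Fin.natAdd (numBase b) i) none) ::
      List.ofFn fun a => PAFA.describeU
        ((haltingPAFA e M X Y g₀ n).deltaU c (Fin.natAdd (numBase b) i) (some a))) =
      countRow e Y g₀ c n i := by
  have hne : (finSuccEquiv b c, modeEquiv b n (Fin.natAdd (numBase b) i)) ≠
      (none, .inl .start) := by
    rw [modeEquiv_natAdd]
    simp
  simp only [haltingPAFA_deltaU_of_next _ _ _ _ _ _ _ _ _ hne, modeEquiv_natAdd, countRow]
  generalize finSuccEquiv b c = c'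
  rcases c' with _ | c'
  · simp [Checker.next, modeEquiv_symm_count]
  · refine congrArg₂ _ (by simp [Checker.next, modeEquiv_symm_inl]) ?_
    congr 1
    funext a
    by_cases h : (e a).cell = some (Y, none)
    · by_cases h' : (i : ℕ) < n
      · simp only [Checker.next, checker, firstRow, h, h', if_true, dif_pos, modeEquiv_symm_count]
        rfl
      · simp only [Checker.next, checker, firstRow, h, h', if_true, dif_neg, if_false,
          not_false_iff, modeEquiv_symm_phase]
    · simp only [Checker.next, checker, firstRow, h, if_false, modeEquiv_symm_inl]

/-- The distinctions by common component and letter are finite and constant; only an addition and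
the test `i < n` vary. -/
theorem primrec_countRow {Γ Λ : Type} {b : ℕ} (e : Fin b ≃ Letter Γ Λ) (Y : Γ)
    (g₀ : Fin b) (c : Fin (b + 1)) : Primrec₂ (countRow e Y g₀ c) := by
  have hadd : ∀ s : ℕ, Primrec fun x : ℕ × ℕ => [(s, numBase b + x.2)] := fun s =>
    Primrec.list_cons.comp (Primrec.pair (Primrec.const s)
      (Primrec.nat_add.comp (Primrec.const _) Primrec.snd)) (Primrec.const [])
  unfold countRow Primrec₂
  rcases finSuccEquiv b c with _ | c'
  · exact Primrec.list_cons.comp (hadd _) (Primrec.list_ofFn fun _ => hadd _)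
  · refine Primrec.list_cons.comp (Primrec.const _) (Primrec.list_ofFn fun a => ?_)
    split_ifs
    · refine Primrec.ite (Primrec.nat_lt.comp Primrec.snd Primrec.fst) ?_ (Primrec.const _)
      exact Primrec.list_cons.comp (Primrec.pair (Primrec.const _)
        (Primrec.succ.comp (Primrec.nat_add.comp (Primrec.const _) Primrec.snd)))
        (Primrec.const [])
    · exact Primrec.const _

/-- Only the number of private states and the table entries of the counter states vary with `n`; the
remaining entries are copied from the automaton for `n = 0`. -/
theorem primrec_describe : Primrec fun n => (haltingPAFA e M X Y g₀ n).describe := by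
  unfold PAFA.describe
  refine Primrec.pair ?_ (Primrec.pair (Primrec.list_ofFn fun c => ?_) (Primrec.pair ?_
    (Primrec.pair (Primrec.list_ofFn fun c => ?_) ?_)))
  · exact Primrec.pair (Primrec.const _) (Primrec.pair
      (Primrec.nat_add.comp (Primrec.const _) Primrec.succ) (Primrec.const _))
  · refine Primrec.ofFn_add (fun i => (haltingPAFA e M X Y g₀ 0).isUniversal c (Fin.castAdd 1 i))
      (fun _ _ => true) (Primrec₂.const _) (fun n i => ?_) (fun n i => ?_)
    · obtain ⟨x, rfl⟩ := (baseEquiv b).surjective i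
      have h₀ := modeEquiv_castAdd b 0 x
      simp only [haltingPAFA, Checker.pafa, modeEquiv_castAdd, h₀]
      rcases x with (_ | _ | _ | _) | _ <;> rfl
    · simp only [haltingPAFA, Checker.pafa, modeEquiv_natAdd]
      rfl
  · exact Primrec.const (List.ofFn fun c => PAFA.describeE ((haltingPAFA e M X Y g₀ 0).deltaE c))
  · refine Primrec.ofFn_add
      (fun i => PAFA.describeU ((haltingPAFA e M X Y g₀ 0).deltaU c (Fin.castAdd 1 i) none) ::
        List.ofFn fun a =>
          PAFA.describeU ((haltingPAFA e M X Y g₀ 0).deltaU c (Fin.castAdd 1 i) (some a)))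
      (countRow e Y g₀ c) (primrec_countRow e Y g₀ c)
      (fun n i => ?_) (fun n i => describeU_deltaU_count e M X Y g₀ n c i)
    obtain ⟨x, rfl⟩ := (baseEquiv b).surjective i
    simp only [describeU_deltaU_base]
  · refine (Primrec.const (((haltingPAFA e M X Y g₀ 0).initC : ℕ),
      ((haltingPAFA e M X Y g₀ 0).initP : ℕ), ((haltingPAFA e M X Y g₀ 0).accept : ℕ),
      ((haltingPAFA e M X Y g₀ 0).reject : ℕ))).of_eq fun n => ?_
    simp [haltingPAFA, Checker.pafa, modeEquiv_symm_inl]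

theorem language_haltingPAFA_eq_empty_iff (n : ℕ) : (haltingPAFA e M X Y g₀ n).language = ∅ ↔
    ¬ (StateTransition.eval (step M) (init (X :: List.replicate (n + 1) Y))).Dom := by
  rw [← exists_accepts_iff (e := e), Set.eq_empty_iff_forall_notMem, not_exists]
  exact forall_congr' fun w => not_congr Checker.mem_language_iff

end Turing.TM0

open Turing TM0 in
/-- The emptiness problem for realtime private alternating finite automata is undecidable: no
computable predicate on finite descriptions holds, among the descriptions of such automata, for
exactly those of the automata that recognize the empty language. -/
theorem mainTheorem2 :
    ¬ ∃ Q : PAFADescription → Prop, ComputablePred Q ∧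
      ∀ (nC nP nA nG nD : ℕ) (M : PAFA (Fin nC) (Fin nP) (Fin nA) (Fin nG) (Fin nD)),
        Q M.describe ↔ M.language = ∅ := by
  rintro ⟨Q, hQ, h⟩
  obtain ⟨Γ, Λ, _, _, _, _, M, X, Y, hM⟩ := exists_TM0_undecidable
  let e : Fin (Nat.card (Letter Γ Λ)) ≃ Letter Γ Λ := (Finite.equivFin _).symm
  have : Nontrivial (Fin (Nat.card (Letter Γ Λ))) :=
    (e.nontrivial_congr).2 inferInstance
  have hred : ComputablePred fun n : ℕ =>
      ¬ (StateTransition.eval (step M) (init (X :: List.replicate (n + 1) Y))).Dom :=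
    ComputablePred.computable_of_manyOneReducible
      ⟨_, (primrec_describe e M X Y (e.symm (none, none, none))).to_comp, fun n => by
        rw [h, language_haltingPAFA_eq_empty_iff]⟩ hQ
  -- Emptiness corresponds to non-halting, so the decision is complemented.
  exact hM (hred.not.of_eq fun n => not_not)
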